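/- Let $A$ be a finite alphabet and let $T:A^{\mathbb Z}\to A^{\mathbb Z}$ be the left shift, $T(\omega)_n=\omega_{n+1}$. Let $\Omega\subset A^{\mathbb Z}$ be a closed $T$-invariant set such that the subshift $(\Omega,T)$ is minimal, i.e. every orbit $\{T^n\omega:n\in\mathbb Z\}$, $\omega\in\Omega$, is dense in $\Omega$. Let $L_n(\Omega)$ be the set of words of length $n$ appearing in sequences of $\Omega$, and let $G_T$ be the topological full group of $(\Omega,T)$: the group of all homeomorphisms $S:\Omega\to\Omega$ of the form $S(x)=T^{f(x)}(x)$ with $f:\Omega\to\mathbb Z$ continuous. Let $G_T'$ be its commutator subgroup. Suppose that $(\Omega,T)$ satisfies the condition $(\dag)$ no word in $L_5(\Omega)$ has repeated letters, i.e. if $w_0w_1w_2w_3w_4\in L_5(\Omega)$, then $w_i\neq w_j$ for $i\neq j$. For $abc\in L_3(\Omega)$ put $[a.bc]=\{\omega\in\Omega:\omega_{-1}=a,\ \omega_0=b,\ \omega_1=c\}$. For a clopen set $U\subset\Omega$ such that $U$, $TU$, $T^2U$ are pairwise disjoint (by $(\dag)$, this holds for every $U=[a.bc]$), let $\sigma_U\in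 G_T$ be the element with $\sigma_U(\omega)=T\omega$ for $\omega\in U\cup TU$, $\sigma_U(\omega)=T^{-2}\omega$ for $\omega\in T^2U$, and $\sigma_U(\omega)=\omega$ otherwise. Then the commutator subgroup $G_T'$ is generated by the finitely many elements $\sigma_{[a.bc]}$, $abc\in L_3(\Omega)$. -/

import Mathlib

/-! ### Topological full groups -/

namespace FullGroup

variable {X : Type*} [TopologicalSpace X]

/-- A homeomorphism `T` is minimal if every two-sided orbit `{T ^ n x : n ∈ ℤ}` is dense. -/
def IsMinimal (T : X ≃ₜ X) : Prop :=
  ∀ x : X, Dense (Set.range fun n : ℤ => (T ^ n) x)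

theorem zpow_add_apply (T : X ≃ₜ X) (m n : ℤ) (x : X) :
    (T ^ (m + n)) x = (T ^ m) ((T ^ n) x) := by
  rw [zpow_add]; rfl

/-- The topological full group of `T`: all homeomorphisms `S` of the form
`S x = T ^ (f x) x` with a continuous orbit cocycle `f : X → ℤ`. -/
def topologicalFullGroup (T : X ≃ₜ X) : Subgroup (X ≃ₜ X) where
  carrier := {S | ∃ f : X → ℤ, Continuous f ∧ ∀ x, S x = (T ^ f x) x}
  one_mem' := ⟨fun _ => 0, continuous_const, fun x => by simp⟩
  mul_mem' := by
    rintro S₁ S₂ ⟨f₁, hf₁, h₁⟩ ⟨f₂, hf₂, h₂⟩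
    refine ⟨fun x => f₁ (S₂ x) + f₂ x, (hf₁.comp S₂.continuous).add hf₂, fun x => ?_⟩
    rw [zpow_add_apply, ← h₂ x, ← h₁ (S₂ x)]
    rfl
  inv_mem' := by
    rintro S ⟨f, hf, h⟩
    refine ⟨fun x => - f (S.symm x), (hf.comp S.symm.continuous).neg, fun x => ?_⟩
    have hx : x = (T ^ f (S.symm x)) (S.symm x) := by rw [← h]; simp
    have h2 : (T ^ (- f (S.symm x))) x = S.symm x := by
      have e := zpow_add_apply T (- f (S.symm x)) (f (S.symm x)) (S.symm x)
      rw [← hx] at e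
      rw [← e]
      simp
    exact h2.symm

/-- `U` is a clopen set such that `U`, `T U`, `T² U` are pairwise disjoint. -/
structure IsThreeTower (T : X ≃ₜ X) (U : Set X) : Prop where
  isClopen : IsClopen U
  disjoint₀₁ : Disjoint U (T '' U)
  disjoint₀₂ : Disjoint U (⇑(T ^ 2) '' U)
  disjoint₁₂ : Disjoint (T '' U) (⇑(T ^ 2) '' U)

open Classical in
/-- The map that is `T` on `U ∪ T U`, `T⁻²` on `T² U`, and the identity elsewhere. -/
noncomputable def sigmaFun (T : X ≃ₜ X) (U : Set X) (x : X) : X :=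
  if x ∈ U ∪ T '' U then T x
  else if x ∈ ⇑(T ^ 2) '' U then (T ^ (-2 : ℤ)) x
  else x

open Classical in
/-- The orbit cocycle of `sigmaFun T U`. -/
noncomputable def sigmaCocycle (T : X ≃ₜ X) (U : Set X) (x : X) : ℤ :=
  if x ∈ U ∪ T '' U then 1
  else if x ∈ ⇑(T ^ 2) '' U then -2
  else 0

theorem sigmaFun_eq (T : X ≃ₜ X) (U : Set X) (x : X) :
    sigmaFun T U x = (T ^ sigmaCocycle T U x) x := by
  unfold sigmaFun sigmaCocycle
  split_ifs <;> simp

theorem continuous_sigmaCocycle {T : X ≃ₜ X} {U : Set X} (h : IsThreeTower T U) :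
    Continuous (sigmaCocycle T U) := by
  have c (S : X ≃ₜ X) : IsClopen (S '' U) :=
    ⟨S.isClosed_image.2 h.isClopen.1, S.isOpen_image.2 h.isClopen.2⟩
  classical
  have hc {V : Set X} (hV : IsClopen V) {f g : X → ℤ} (hf : Continuous f) (hg : Continuous g) :
      Continuous fun x => if x ∈ V then f x else g x := by
    refine hf.if (fun a ha => ?_) hg
    exact absurd ha (by simp only [Set.ofPred_mem_eq, hV.frontier_eq]; simp)
  convert hc (h.isClopen.union (c T)) (continuous_const (y := (1 : ℤ)))
    (hc (c (T ^ 2)) (continuous_const (y := (-2 : ℤ))) (continuous_const (y := (0 : ℤ))))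
    using 2 with x
  unfold sigmaCocycle
  congr

theorem continuous_sigmaFun {T : X ≃ₜ X} {U : Set X} (h : IsThreeTower T U) :
    Continuous (sigmaFun T U) := by
  refine continuous_iff_continuousAt.2 fun x => ?_
  refine (T ^ sigmaCocycle T U x).continuous.continuousAt.congr ?_
  filter_upwards [(continuous_sigmaCocycle h).continuousAt.preimage_mem_nhds
    (show {sigmaCocycle T U x} ∈ nhds (sigmaCocycle T U x) from
      (isOpen_discrete _).mem_nhds rfl)] with y hy
  rw [sigmaFun_eq, show sigmaCocycle T U y = sigmaCocycle T U x from hy]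

theorem sigmaFun_cube {T : X ≃ₜ X} {U : Set X} (h : IsThreeTower T U) (x : X) :
    sigmaFun T U (sigmaFun T U (sigmaFun T U x)) = x := by
  have e0 : ∀ u ∈ U, sigmaFun T U u = T u := fun u hu => by
    simp [sigmaFun, hu]
  have e1 : ∀ u ∈ U, sigmaFun T U (T u) = (T ^ 2) u := fun u hu => by
    simp [sigmaFun, hu, pow_two]
  have e2 : ∀ u ∈ U, sigmaFun T U ((T ^ 2) u) = u := fun u hu => by
    have hm : (T ^ 2) u ∈ ⇑(T ^ 2) '' U := ⟨u, hu, rfl⟩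
    have h1 : (T ^ 2) u ∉ U ∪ T '' U := by
      rintro (h' | h')
      · exact Set.disjoint_left.1 h.disjoint₀₂ h' hm
      · exact Set.disjoint_left.1 h.disjoint₁₂ h' hm
    have : (T ^ (-2 : ℤ)) ((T ^ 2) u) = u := by
      rw [show (T ^ 2 : X ≃ₜ X) = T ^ (2 : ℤ) by norm_cast, ← zpow_add_apply]
      simp
    rw [sigmaFun, if_neg h1, if_pos hm, this]
  by_cases h0 : x ∈ U
  · rw [e0 x h0, e1 x h0, e2 x h0]
  by_cases h1 : x ∈ T '' U
  · obtain ⟨u, hu, rfl⟩ := h1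
    rw [e1 u hu, e2 u hu, e0 u hu]
  by_cases h2 : x ∈ ⇑(T ^ 2) '' U
  · obtain ⟨u, hu, rfl⟩ := h2
    rw [e2 u hu, e0 u hu, e1 u hu]
  have e : sigmaFun T U x = x := by
    rw [sigmaFun, if_neg (by rintro (h' | h') <;> contradiction), if_neg h2]
  rw [e, e, e]

/-- `σ_U` as a homeomorphism (its inverse is its square). -/
noncomputable def sigmaHomeo (T : X ≃ₜ X) (U : Set X) (h : IsThreeTower T U) : X ≃ₜ X where
  toFun := sigmaFun T U
  invFun x := sigmaFun T U (sigmaFun T U x)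
  left_inv := sigmaFun_cube h
  right_inv := sigmaFun_cube h
  continuous_toFun := continuous_sigmaFun h
  continuous_invFun := (continuous_sigmaFun h).comp (continuous_sigmaFun h)

/-- The element `σ_U` of the topological full group: `T` on `U ∪ T U`, `T⁻²` on `T² U`, and
the identity elsewhere. -/
noncomputable def sigma (T : X ≃ₜ X) (U : Set X) (h : IsThreeTower T U) :
    topologicalFullGroup T :=
  ⟨sigmaHomeo T U h, sigmaCocycle T U, continuous_sigmaCocycle h, sigmaFun_eq T U⟩

end FullGroup

/-! ### Subshifts over `ℤ` -/

namespace ZSubshift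

open SymbolicDynamics.FullShift

variable {A : Type*} [TopologicalSpace A]

theorem translate_mem (Ω : Subshift A ℤ) (k : ℤ) {x : ℤ → A} (hx : x ∈ Ω.carrier) :
    (fun n => x (n + k)) ∈ Ω.carrier := by
  have e : shift k x = fun n => x (n + k) := by
    funext n; simp [add_comm]
  exact e ▸ Ω.mapsTo k hx

theorem continuous_translate (Ω : Subshift A ℤ) (k : ℤ) :
    Continuous fun x : Ω.carrier =>
      (⟨fun n => x.1 (n + k), translate_mem Ω k x.2⟩ : Ω.carrier) := by
  refine Continuous.subtype_mk (continuous_pi fun n => ?_) _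
  exact (continuous_apply (n + k)).comp continuous_subtype_val

/-- The left shift `(T x) n = x (n + 1)` as a homeomorphism of the subshift. -/
def leftShift (Ω : Subshift A ℤ) : Ω.carrier ≃ₜ Ω.carrier where
  toFun x := ⟨fun n => x.1 (n + 1), translate_mem Ω 1 x.2⟩
  invFun x := ⟨fun n => x.1 (n + -1), translate_mem Ω (-1) x.2⟩
  left_inv x := by ext n; simp
  right_inv x := by ext n; simp
  continuous_toFun := continuous_translate Ω 1
  continuous_invFun := continuous_translate Ω (-1)

/-- `L_n(Ω)`: the words of length `n` that appear in sequences of `Ω`. -/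
def language (Ω : Subshift A ℤ) (n : ℕ) : Set (Fin n → A) :=
  {w | ∃ x ∈ Ω.carrier, ∃ k : ℤ, ∀ i : Fin n, x (k + (i : ℕ)) = w i}

/-- Condition (†): no word of length five in the language has repeated letters. -/
def Dagger (Ω : Subshift A ℤ) : Prop :=
  ∀ w ∈ language Ω 5, Function.Injective w

/-- The cylinder set `[u.v]`: the sequences of `Ω` in which `u` occupies the coordinates
`-|u|, …, -1` and `v` the coordinates `0, …, |v| - 1`. -/
def cylinder (Ω : Subshift A ℤ) {p q : ℕ} (u : Fin p → A) (v : Fin q → A) : Set Ω.carrier :=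
  {x | (∀ i : Fin p, x.1 ((i : ℕ) - (p : ℤ)) = u i) ∧ ∀ i : Fin q, x.1 (i : ℕ) = v i}

theorem isClopen_cylinder [DiscreteTopology A] (Ω : Subshift A ℤ) {p q : ℕ}
    (u : Fin p → A) (v : Fin q → A) : IsClopen (cylinder Ω u v) := by
  have key : ∀ (n : ℤ) (a : A), IsClopen {x : Ω.carrier | x.1 n = a} := fun n a =>
    (isClopen_discrete {a}).preimage
      ((continuous_apply n).comp continuous_subtype_val)
  have : cylinder Ω u v = (⋂ i : Fin p, {x : Ω.carrier | x.1 ((i : ℕ) - (p : ℤ)) = u i}) ∩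
      ⋂ i : Fin q, {x : Ω.carrier | x.1 (i : ℕ) = v i} := by
    ext x; simp [cylinder]
  rw [this]
  exact (isClopen_iInter_of_finite fun i => key _ _).inter
    (isClopen_iInter_of_finite fun i => key _ _)

theorem Dagger.apply_ne {Ω : Subshift A ℤ} (h : Dagger Ω) (x : Ω.carrier) (n : ℤ) {m : ℕ}
    (h0 : 0 < m) (h5 : m < 5) : x.1 n ≠ x.1 (n + m) := by
  intro e
  have := h (fun i : Fin 5 => x.1 (n + (i : ℕ))) ⟨x.1, x.2, n, fun _ => rfl⟩
    (a₁ := ⟨0, by omega⟩) (a₂ := ⟨m, h5⟩) (by simpa using e)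
  simp at this
  exact h0.ne' this

/-- Under (†) the sets `[a.bc]`, `T [a.bc]`, `T² [a.bc]` are pairwise disjoint. -/
theorem Dagger.isThreeTower [DiscreteTopology A] {Ω : Subshift A ℤ} (h : Dagger Ω) (a b c : A) :
    FullGroup.IsThreeTower (leftShift Ω) (cylinder Ω ![a] ![b, c]) := by
  have ha : ∀ x ∈ cylinder Ω ![a] ![b, c], x.1 (-1) = a := fun x hx => by
    simpa using hx.1 0
  have d1 : Disjoint (cylinder Ω ![a] ![b, c]) (leftShift Ω '' cylinder Ω ![a] ![b, c]) := by
    refine Set.disjoint_left.2 ?_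
    rintro _ hx ⟨y, hy, rfl⟩
    have e : y.1 (-1 + (1 : ℕ)) = a := by
      simpa [leftShift, pow_two] using ha _ hx
    exact h.apply_ne y (-1) (by omega) (by omega) ((ha y hy).trans e.symm)
  refine ⟨isClopen_cylinder Ω _ _, d1, ?_, ?_⟩
  · refine Set.disjoint_left.2 ?_
    rintro _ hx ⟨y, hy, rfl⟩
    have e : y.1 (-1 + (2 : ℕ)) = a := by
      simpa [leftShift, pow_two] using ha _ hx
    exact h.apply_ne y (-1) (by omega) (by omega) ((ha y hy).trans e.symm)
  · refine Set.disjoint_left.2 ?_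
    rintro _ ⟨z, hz, rfl⟩ ⟨y, hy, e⟩
    have : leftShift Ω y = z := (leftShift Ω).injective e
    exact Set.disjoint_left.1 d1 hz ⟨y, hy, this⟩

/-- The elements `σ_[a.bc]`, `abc ∈ L_3(Ω)`, of the topological full group. -/
def generators [DiscreteTopology A] (Ω : Subshift A ℤ) (h : Dagger Ω) :
    Set (FullGroup.topologicalFullGroup (leftShift Ω)) :=
  {g | ∃ a b c : A, ![a, b, c] ∈ language Ω 3 ∧
    g = FullGroup.sigma (leftShift Ω) (cylinder Ω ![a] ![b, c]) (h.isThreeTower a b c)}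

end ZSubshift

/-! Write `G` for the topological full group and `N` for the subgroup generated by all `σ_U`. The
theorem splits into `G' = N`, which needs only a minimal homeomorphism of a compact, totally
disconnected Hausdorff space, and the reduction of every `σ_U` to the cylinders `[a.bc]`, which uses
(†).

The common language is that of towers: elements `g i` of `G` and a clopen base `W` whose translates
are disjoint. Permuting the levels gives a homomorphism `rho` from permutations to `G`, and `σ_U` is
a 3-cycle on `U, TU, T²U`. A 3-cycle is a commutator of transpositions, so `N ≤ G'`.

For the converse, over a small base any finite family in `G` acts by powers of `T` lying in one
tower `T^m W, …, T^(m+n) W` (`exists_segment`). Products of adjacent transpositions sharing a level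
are elements `σ_U`, and they generate the alternating group; hence every even permutation of every
tower lies in `N` (`IsTower.rho_mem`). So `N` is normal, and a swap of two levels agrees with each
of its conjugates modulo `N`, two transpositions having an even product. As `T` and the swaps
generate `G` (`IsMinimal.eq_top`, by first return maps), `G/N` is abelian and `G' ≤ N`.

Finally, when the towers over `U` and `V` meet only in `T²U ∩ V`, a commutator of `σ_V` and `σ_U⁻¹`
is `σ_D` with `D = TU ∩ T⁻¹V` (`sigma_inter_mem`). Condition (†) ensures this for suitable
cylinders, so the windows can be enlarged from `[-1, 1]` to any `[-N, N]`; a clopen `U` is a finite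
disjoint union of such cylinders. -/

/-! ### The action of the full group and generalized towers -/

namespace FullGroup

section Action

variable {X : Type*} [TopologicalSpace X] {T : X ≃ₜ X}

/-- The tautological action of the topological full group. -/
instance : MulAction (topologicalFullGroup T) X where
  smul g x := g.1 x
  one_smul _ := rfl
  mul_smul _ _ _ := rfl

theorem smul_def (g : topologicalFullGroup T) (x : X) : g • x = g.1 x := rfl

instance : FaithfulSMul (topologicalFullGroup T) X where
  eq_of_smul_eq_smul h := Subtype.ext (Homeomorph.ext h)

theorem continuous_smul_left (g : topologicalFullGroup T) : Continuous fun x : X => g • x :=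
  g.1.continuous

theorem isClopen_preimage_smul (g : topologicalFullGroup T) {W : Set X} (hW : IsClopen W) :
    IsClopen {x : X | g • x ∈ W} :=
  hW.preimage (continuous_smul_left g)

variable (T) in
/-- The homeomorphism `T` as an element of its topological full group. -/
def gen : topologicalFullGroup T :=
  ⟨T, fun _ => 1, continuous_const, fun x => by simp⟩

theorem gen_smul (x : X) : gen T • x = T x := rfl

theorem gen_zpow_smul (n : ℤ) (x : X) : gen T ^ n • x = (T ^ n) x := by
  rw [smul_def, Subgroup.coe_zpow]; rfl

theorem exists_cocycle (g : topologicalFullGroup T) :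
    ∃ f : X → ℤ, Continuous f ∧ ∀ x, g • x = gen T ^ f x • x := by
  obtain ⟨f, hf, h⟩ := g.2
  exact ⟨f, hf, fun x => by rw [gen_zpow_smul]; exact h x⟩

/-- A map that agrees with continuous maps on the pieces of a finite family of clopen sets and on
the complement of their union is continuous. -/
theorem continuous_of_piecewise {ι Z : Type*} [Finite ι] [TopologicalSpace Z] {P : ι → Set X}
    (hP : ∀ i, IsClopen (P i)) {φ : X → Z} {ψ : ι → X → Z} {ψ' : X → Z}
    (hψ : ∀ i, Continuous (ψ i)) (hψ' : Continuous ψ')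
    (e : ∀ i, ∀ x ∈ P i, φ x = ψ i x) (e' : ∀ x, (∀ i, x ∉ P i) → φ x = ψ' x) :
    Continuous φ := by
  have hopen : IsOpen {x | ∀ i, x ∉ P i} := by
    have : {x | ∀ i, x ∉ P i} = ⋂ i, (P i)ᶜ := by ext; simp
    rw [this]
    exact isOpen_iInter_of_finite fun i => (hP i).compl.isOpen
  refine continuous_iff_continuousAt.2 fun x => ?_
  by_cases hx : ∃ i, x ∈ P i
  · obtain ⟨i, hx⟩ := hx
    refine (hψ i).continuousAt.congr ?_
    filter_upwards [(hP i).isOpen.mem_nhds hx] with y hy using (e i y hy).symm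
  · refine hψ'.continuousAt.congr ?_
    filter_upwards [hopen.mem_nhds (by simpa using hx)] with y hy using (e' y hy).symm

/-- The translates `g i • W` of the clopen set `W` are pairwise disjoint. -/
structure IsTower {ι : Type*} (g : ι → topologicalFullGroup T) (W : Set X) : Prop where
  isClopen : IsClopen W
  index_eq : ∀ i j, ∀ v ∈ W, ∀ w ∈ W, g i • v = g j • w → i = j

namespace IsTower

variable {ι κ : Type*} {g : ι → topologicalFullGroup T} {U V W : Set X}

theorem mono (h : IsTower g W) (hU : IsClopen U) (hUW : U ⊆ W) : IsTower g U :=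
  ⟨hU, fun i j v hv w hw => h.index_eq i j v (hUW hv) w (hUW hw)⟩

theorem conj (h : IsTower g W) (k : topologicalFullGroup T) : IsTower (fun i => k * g i) W :=
  ⟨h.isClopen, fun i j v hv w hw e => h.index_eq i j v hv w hw (by
    simpa only [mul_smul, smul_left_cancel_iff] using e)⟩

theorem comp (h : IsTower g W) (e : κ ↪ ι) : IsTower (fun k => g (e k)) W :=
  ⟨h.isClopen, fun _ _ v hv w hw he => e.injective (h.index_eq _ _ v hv w hw he)⟩

theorem congr (h : IsTower g W) {g' : ι → topologicalFullGroup T}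
    (e : ∀ i, ∀ w ∈ W, g i • w = g' i • w) : IsTower g' W :=
  ⟨h.isClopen, fun i j v hv w hw he => h.index_eq i j v hv w hw (by
    rw [e i v hv, e j w hw, he])⟩

open Classical in
/-- The map that permutes the levels of a tower. -/
noncomputable def permFun (g : ι → topologicalFullGroup T) (W : Set X) (π : Equiv.Perm ι)
    (x : X) : X :=
  if h : ∃ i, (g i)⁻¹ • x ∈ W then (g (π h.choose) * (g h.choose)⁻¹) • x else x

theorem permFun_smul (h : IsTower g W) (π : Equiv.Perm ι) (i : ι) {w : X} (hw : w ∈ W) :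
    permFun g W π (g i • w) = g (π i) • w := by
  have hx : ∃ j, (g j)⁻¹ • g i • w ∈ W := ⟨i, by simpa using hw⟩
  have e : hx.choose = i := h.index_eq _ _ _ hx.choose_spec w hw (by simp)
  rw [permFun, dif_pos hx, e]
  simp [mul_smul]

theorem permFun_of_notMem (π : Equiv.Perm ι) {x : X} (hx : ∀ i, (g i)⁻¹ • x ∉ W) :
    permFun g W π x = x := by
  rw [permFun, dif_neg]; simpa using hx

theorem permFun_mul (h : IsTower g W) (π ρ : Equiv.Perm ι) (x : X) :
    permFun g W (π * ρ) x = permFun g W π (permFun g W ρ x) := by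
  by_cases hx : ∃ i, (g i)⁻¹ • x ∈ W
  · obtain ⟨i, hi⟩ := hx
    obtain ⟨w, hw, rfl⟩ : ∃ w ∈ W, g i • w = x := ⟨_, hi, by simp⟩
    simp [permFun_smul h _ _ hw]
  · have hx : ∀ i, (g i)⁻¹ • x ∉ W := by simpa using hx
    simp [permFun_of_notMem _ hx]

theorem permFun_one (h : IsTower g W) (x : X) : permFun g W 1 x = x := by
  by_cases hx : ∃ i, (g i)⁻¹ • x ∈ W
  · obtain ⟨i, hi⟩ := hx
    obtain ⟨w, hw, rfl⟩ : ∃ w ∈ W, g i • w = x := ⟨_, hi, by simp⟩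
    simp [permFun_smul h _ _ hw]
  · exact permFun_of_notMem _ (by simpa using hx)

theorem isClopen_level (h : IsTower g W) (i : ι) : IsClopen {x | (g i)⁻¹ • x ∈ W} :=
  isClopen_preimage_smul _ h.isClopen

theorem continuous_permFun [Finite ι] (h : IsTower g W) (π : Equiv.Perm ι) :
    Continuous (permFun g W π) := by
  refine continuous_of_piecewise (P := fun i => {x | (g i)⁻¹ • x ∈ W}) h.isClopen_level
    (ψ := fun i x => (g (π i) * (g i)⁻¹) • x) (fun i => continuous_smul_left _) continuous_id
    (fun i x hx => ?_) (fun x hx => permFun_of_notMem π hx)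
  conv_lhs => rw [← smul_inv_smul (g i) x]
  rw [permFun_smul h π i hx, mul_smul]

theorem exists_permCocycle [Finite ι] (h : IsTower g W) (π : Equiv.Perm ι) :
    ∃ f : X → ℤ, Continuous f ∧ ∀ x, permFun g W π x = (T ^ f x) x := by
  classical
  choose F hF hFx using fun g : topologicalFullGroup T => exists_cocycle g
  let f : X → ℤ := fun x => if hx : ∃ i, (g i)⁻¹ • x ∈ W then
    F (g (π hx.choose) * (g hx.choose)⁻¹) x else 0
  refine ⟨f, ?_, fun x => ?_⟩
  · refine continuous_of_piecewise (P := fun i => {x | (g i)⁻¹ • x ∈ W}) h.isClopen_level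
      (ψ := fun i x => F (g (π i) * (g i)⁻¹) x) (fun i => hF _) (continuous_const (y := 0))
      (fun i x hx => ?_) (fun x hx => ?_)
    · have hx' : ∃ i, (g i)⁻¹ • x ∈ W := ⟨i, hx⟩
      have e : hx'.choose = i := h.index_eq _ _ _ hx'.choose_spec _ hx (by simp)
      simp only [f, dif_pos hx', e]
    · simp only [f]
      exact dif_neg (by simpa using hx)
  · by_cases hx : ∃ i, (g i)⁻¹ • x ∈ W
    · rw [← gen_zpow_smul]
      simp only [f, permFun, dif_pos hx]
      exact hFx _ x
    · simp only [f, permFun, dif_neg hx]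
      simp

/-- The permutations of the levels of a tower, as elements of the topological full group. -/
noncomputable def rho [Finite ι] (h : IsTower g W) : Equiv.Perm ι →* topologicalFullGroup T :=
  MonoidHom.mk' (fun π => ⟨{
      toFun := permFun g W π
      invFun := permFun g W π⁻¹
      left_inv := fun x => by rw [← permFun_mul h, inv_mul_cancel, permFun_one h]
      right_inv := fun x => by rw [← permFun_mul h, mul_inv_cancel, permFun_one h]
      continuous_toFun := continuous_permFun h π
      continuous_invFun := continuous_permFun h π⁻¹ }, exists_permCocycle h π⟩)
    fun π ρ => Subtype.ext (Homeomorph.ext (permFun_mul h π ρ))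

variable [Finite ι] [Finite κ]

theorem rho_smul (h : IsTower g W) (π : Equiv.Perm ι) (i : ι) {w : X} (hw : w ∈ W) :
    h.rho π • g i • w = g (π i) • w :=
  permFun_smul h π i hw

theorem rho_smul_of_notMem (h : IsTower g W) (π : Equiv.Perm ι) {x : X}
    (hx : ∀ i, ∀ w ∈ W, g i • w ≠ x) : h.rho π • x = x :=
  permFun_of_notMem π fun i hi => hx i _ hi (by simp)

theorem rho_unique (h : IsTower g W) (π : Equiv.Perm ι) {s : topologicalFullGroup T}
    (h1 : ∀ i, ∀ w ∈ W, s • g i • w = g (π i) • w)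
    (h2 : ∀ x, (∀ i, ∀ w ∈ W, g i • w ≠ x) → s • x = x) : s = h.rho π := by
  refine eq_of_smul_eq_smul (α := X) fun x => ?_
  by_cases hx : ∃ i, ∃ w ∈ W, g i • w = x
  · obtain ⟨i, w, hw, rfl⟩ := hx
    rw [h1 i w hw, h.rho_smul π i hw]
  · push Not at hx
    rw [h2 x hx, h.rho_smul_of_notMem π hx]

theorem rho_eq_one_of_empty (h : IsTower g ∅) (π : Equiv.Perm ι) : h.rho π = 1 :=
  (h.rho_unique π (fun _ _ hw => hw.elim) fun x _ => one_smul _ x).symm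

/-- Since `rho` is multiplicative in the base, membership statements need only be checked over small
bases. -/
theorem rho_union (h : IsTower g (U ∪ V)) (hU : IsTower g U) (hV : IsTower g V)
    (hd : Disjoint U V) (π : Equiv.Perm ι) : h.rho π = hU.rho π * hV.rho π := by
  have key : ∀ i j, ∀ u ∈ U, ∀ v ∈ V, g i • u ≠ g j • v := fun i j u hu v hv e => by
    obtain rfl := h.index_eq i j u (.inl hu) v (.inr hv) e
    obtain rfl := (smul_left_cancel_iff _).1 e
    exact Set.disjoint_left.1 hd hu hv
  refine (h.rho_unique π ?_ ?_).symm
  · rintro i w (hw | hw)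
    · rw [mul_smul, hV.rho_smul_of_notMem π fun j v hv e => key i j w hw v hv e.symm,
        hU.rho_smul π i hw]
    · rw [mul_smul, hV.rho_smul π i hw, hU.rho_smul_of_notMem π fun j v hv e => key _ _ v hv w hw e]
  · intro x hx
    rw [mul_smul, hV.rho_smul_of_notMem π fun i w hw => hx i w (.inr hw),
      hU.rho_smul_of_notMem π fun i w hw => hx i w (.inl hw)]

theorem rho_conj (h : IsTower g W) (k : topologicalFullGroup T) (π : Equiv.Perm ι) :
    (h.conj k).rho π = k * h.rho π * k⁻¹ := by
  refine ((h.conj k).rho_unique π (fun i w hw => ?_) fun x hx => ?_).symm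
  · simp [mul_smul, h.rho_smul π i hw]
  · rw [mul_smul, mul_smul, h.rho_smul_of_notMem π fun i w hw e => hx i w hw ?_, smul_inv_smul]
    rw [mul_smul, e, smul_inv_smul]

theorem rho_congr (h : IsTower g W) {g' : ι → topologicalFullGroup T} (h' : IsTower g' W)
    (e : ∀ i, ∀ w ∈ W, g i • w = g' i • w) (π : Equiv.Perm ι) : h.rho π = h'.rho π := by
  refine h'.rho_unique π (fun i w hw => ?_) fun x hx => ?_
  · rw [← e i w hw, ← e (π i) w hw, h.rho_smul π i hw]
  · exact h.rho_smul_of_notMem π fun i w hw => by rw [e i w hw]; exact hx i w hw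

theorem rho_comp [Fintype κ] [DecidableEq ι] (h : IsTower g W) (e : κ ↪ ι) (π : Equiv.Perm κ) :
    (h.comp e).rho π = h.rho (π.viaFintypeEmbedding e) := by
  refine h.rho_unique _ (fun i w hw => ?_) fun x hx => ?_
  · by_cases hi : i ∈ Set.range e
    · obtain ⟨k, rfl⟩ := hi
      rw [Equiv.Perm.viaFintypeEmbedding_apply_image]
      exact (h.comp e).rho_smul π k hw
    · rw [Equiv.Perm.viaFintypeEmbedding_apply_notMem_range _ _ hi]
      refine (h.comp e).rho_smul_of_notMem π fun k v hv he => hi ⟨k, ?_⟩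
      exact h.index_eq _ _ v hv w hw he
  · exact (h.comp e).rho_smul_of_notMem π fun k w hw => hx _ w hw

end IsTower

/-- The family `1, T, T²`. -/
def genPow (T : X ≃ₜ X) (j : Fin 3) : topologicalFullGroup T := gen T ^ (j : ℕ)

theorem IsThreeTower.isTower {U : Set X} (h : IsThreeTower T U) : IsTower (genPow T) U := by
  have e0 (x : X) : genPow T 0 • x = x := by simp [genPow]
  have e1 (x : X) : genPow T 1 • x = T x := by simp [genPow, gen_smul]
  have e2 (x : X) : genPow T 2 • x = (T ^ 2) x := by simp [genPow, pow_two, mul_smul, gen_smul]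
  have d1 := Set.disjoint_left.1 h.disjoint₀₁
  have d2 := Set.disjoint_left.1 h.disjoint₀₂
  have d3 := Set.disjoint_left.1 h.disjoint₁₂
  refine ⟨h.isClopen, fun i j v hv w hw e => ?_⟩
  fin_cases i <;> fin_cases j <;>
    simp only [Fin.zero_eta, Fin.mk_one, Fin.reduceFinMk, e0, e1, e2] at e ⊢
  · exact (d1 hv ⟨w, hw, e.symm⟩).elim
  · exact (d2 hv ⟨w, hw, e.symm⟩).elim
  · exact (d1 hw ⟨v, hv, e⟩).elim
  · exact (d3 ⟨v, hv, rfl⟩ ⟨w, hw, e.symm⟩).elim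
  · exact (d2 hw ⟨v, hv, e⟩).elim
  · exact (d3 ⟨w, hw, rfl⟩ ⟨v, hv, e⟩).elim

theorem IsTower.isThreeTower {U : Set X} (h : IsTower (genPow T) U) : IsThreeTower T U := by
  have e0 (x : X) : genPow T 0 • x = x := by simp [genPow]
  have e1 (x : X) : genPow T 1 • x = T x := by simp [genPow, gen_smul]
  have e2 (x : X) : genPow T 2 • x = (T ^ 2) x := by simp [genPow, pow_two, mul_smul, gen_smul]
  refine ⟨h.isClopen, Set.disjoint_left.2 ?_, Set.disjoint_left.2 ?_, Set.disjoint_left.2 ?_⟩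
  · rintro x hx ⟨y, hy, e⟩
    exact absurd (h.index_eq 0 1 x hx y hy (by rw [e0, e1, e])) (by decide)
  · rintro x hx ⟨y, hy, e⟩
    exact absurd (h.index_eq 0 2 x hx y hy (by rw [e0, e2, e])) (by decide)
  · rintro _ ⟨x, hx, rfl⟩ ⟨y, hy, e⟩
    exact absurd (h.index_eq 1 2 x hx y hy (by rw [e1, e2, e])) (by decide)

theorem sigma_eq_rho {U : Set X} (h : IsThreeTower T U) :
    sigma T U h = h.isTower.rho (finRotate 3) := by
  have e0 (x : X) : genPow T 0 • x = x := by simp [genPow]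
  have e1 (x : X) : genPow T 1 • x = T x := by simp [genPow, gen_smul]
  have e2 (x : X) : genPow T 2 • x = (T ^ 2) x := by simp [genPow, pow_two, mul_smul, gen_smul]
  have hσ (x : X) : sigma T U h • x = sigmaFun T U x := rfl
  refine h.isTower.rho_unique _ (fun i w hw => ?_) fun x hx => ?_
  · have hm : (T ^ 2) w ∈ ⇑(T ^ 2) '' U := ⟨w, hw, rfl⟩
    rw [hσ]
    fin_cases i
    · simp [e0, e1, sigmaFun, hw]
    · simp [e1, e2, sigmaFun, hw, pow_two]
    · have h1 : (T ^ 2) w ∉ U ∪ T '' U := by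
        rintro (h' | h')
        · exact Set.disjoint_left.1 h.disjoint₀₂ h' hm
        · exact Set.disjoint_left.1 h.disjoint₁₂ h' hm
      simp only [Fin.reduceFinMk, e2]
      rw [sigmaFun, if_neg h1, if_pos hm, show finRotate 3 2 = 0 from rfl, e0,
        show (T ^ 2 : X ≃ₜ X) = T ^ (2 : ℤ) by norm_cast, ← zpow_add_apply]
      simp
  · rw [hσ, sigmaFun, if_neg, if_neg]
    · rintro ⟨w, hw, rfl⟩
      exact hx 2 w hw (e2 w)
    · rintro (h' | ⟨w, hw, rfl⟩)
      · exact hx 0 x h' (e0 x)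
      · exact hx 1 w hw (e1 w)

end Action
end FullGroup

/-! ### Even permutations of towers -/

/-- A subgroup that contains all products `(i i+1)(i+1 i+2)` contains all even permutations. -/
theorem Equiv.Perm.mem_of_sign_eq_one {n : ℕ} (K : Subgroup (Equiv.Perm (Fin (n + 1))))
    (hK : ∀ i j : Fin n, (i : ℕ) + 1 = j →
      Equiv.swap i.castSucc i.succ * Equiv.swap j.castSucc j.succ ∈ K)
    (π : Equiv.Perm (Fin (n + 1))) (hπ : Equiv.Perm.sign π = 1) : π ∈ K := by
  set s : Fin n → Equiv.Perm (Fin (n + 1)) := fun i => Equiv.swap i.castSucc i.succ with hs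
  have ss (i) : s i * s i = 1 := Equiv.swap_mul_self _ _
  have le : ∀ k : ℕ, ∀ i j : Fin n, (i : ℕ) + k = j → s i * s j ∈ K := by
    intro k
    induction k with
    | zero =>
      intro i j h
      obtain rfl : i = j := Fin.ext (by simpa using h)
      rw [ss]; exact K.one_mem
    | succ k ih =>
      intro i j h
      let l : Fin n := ⟨i + k, by omega⟩
      have := K.mul_mem (ih i l rfl) (hK l j (by simp only [l]; omega))
      have e : s i * s l * (s l * s j) = s i * s j := by
        rw [mul_assoc, ← mul_assoc (s l), ss, one_mul]
      exact e ▸ this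
  have all (i j) : s i * s j ∈ K := by
    rcases le_total (i : ℕ) j with h | h
    · exact le (j - i) i j (by omega)
    · have := K.inv_mem (le (i - j) j i (by omega))
      rwa [mul_inv_rev, show (s i)⁻¹ = s i from Equiv.swap_inv _ _,
        show (s j)⁻¹ = s j from Equiv.swap_inv _ _] at this
  have sg (i) : Equiv.Perm.sign (s i) = -1 := Equiv.Perm.sign_swap (Fin.castSucc_lt_succ).ne
  -- The odd case is carried along so that the induction on words closes: an odd word lies in `K`
  -- after one more adjacent transposition, whichever it is.
  have main : (Equiv.Perm.sign π = 1 → π ∈ K) ∧ (Equiv.Perm.sign π = -1 → ∀ i, π * s i ∈ K) := by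
    have hmem : π ∈ Submonoid.closure (Set.range s) := by
      rw [hs, Equiv.Perm.mclosure_swap_castSucc_succ]; trivial
    clear hπ
    induction hmem using Submonoid.closure_induction_right with
    | one => exact ⟨fun _ => K.one_mem, fun h => absurd h (by simp)⟩
    | mul_right x hx y hy ih =>
      obtain ⟨j, rfl⟩ := hy
      refine ⟨fun h => ih.2 ?_ j, fun h i => ?_⟩
      · rw [Equiv.Perm.sign_mul, sg] at h
        simpa [neg_eq_iff_eq_neg] using h
      · rw [Equiv.Perm.sign_mul, sg] at h
        rw [mul_assoc]
        exact K.mul_mem (ih.1 (by simpa using h)) (all j i)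
  exact main.1 hπ

/-! ### Compactness and clopen neighbourhoods: from local to global. -/

namespace FullGroup

section Induction

variable {X : Type*} [TopologicalSpace X] [CompactSpace X] [T2Space X] [TotallyDisconnectedSpace X]

omit [T2Space X] [TotallyDisconnectedSpace X] in
/-- A property of clopen sets that holds locally and passes to disjoint unions holds globally. -/
theorem clopen_induction {P : Set X → Prop} (h0 : P ∅)
    (hunion : ∀ U V, IsClopen U → IsClopen V → Disjoint U V → P U → P V → P (U ∪ V))
    (hloc : ∀ x, ∃ N, IsClopen N ∧ x ∈ N ∧ ∀ V ⊆ N, IsClopen V → P V) {U : Set X}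
    (hU : IsClopen U) : P U := by
  classical
  choose N hN hx hP using hloc
  obtain ⟨t, ht⟩ := isCompact_univ.elim_finite_subcover N (fun x => (hN x).isOpen)
    fun x _ => Set.mem_iUnion.2 ⟨x, hx x⟩
  have key : ∀ t : Finset X, ∀ U, IsClopen U → U ⊆ ⋃ x ∈ t, N x → P U := by
    intro t
    induction t using Finset.induction_on with
    | empty =>
      intro U _ h
      obtain rfl : U = ∅ := Set.subset_empty_iff.1 (by simpa using h)
      exact h0
    | insert a t _ ih =>
      intro U hU h
      rw [← Set.inter_union_sdiff U (N a)]
      refine hunion _ _ (hU.inter (hN a)) (hU.diff (hN a))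
        (Set.disjoint_left.2 fun x hx hx' => hx'.2 hx.2)
        (hP a _ Set.inter_subset_right (hU.inter (hN a))) (ih _ (hU.diff (hN a)) ?_)
      rintro x ⟨hxU, hxa⟩
      have := h hxU
      simp only [Finset.mem_insert, Set.iUnion_iUnion_eq_or_left] at this
      exact this.resolve_left hxa
  exact key t U hU ((Set.subset_univ U).trans ht)

theorem exists_clopen_disjoint {f : X → X} (hf : Continuous f) {x : X} (h : f x ≠ x) :
    ∃ N, IsClopen N ∧ x ∈ N ∧ ∀ y ∈ N, f y ∉ N := by
  obtain ⟨A, B, hA, hB, hfA, hxB, hd⟩ := t2_separation h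
  obtain ⟨N, hN, hxN, hNs⟩ := compact_exists_isClopen_in_isOpen (hB.inter (hA.preimage hf))
    (show x ∈ B ∩ f ⁻¹' A from ⟨hxB, hfA⟩)
  exact ⟨N, hN, hxN, fun y hy hy' => Set.disjoint_left.1 hd (hNs hy).2 (hNs hy').1⟩

end Induction

/-! ### Local structure: segments of orbits. -/

section Local

variable {X : Type*} [TopologicalSpace X] {T : X ≃ₜ X}

theorem gen_zpow_add_smul (m n : ℤ) (x : X) :
    gen T ^ (m + n) • x = gen T ^ m • gen T ^ n • x := by
  rw [zpow_add, mul_smul]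

theorem gen_zpow_smul_eq_iff (m n : ℤ) (x y : X) :
    gen T ^ m • x = gen T ^ n • y ↔ gen T ^ (m - n) • x = y := by
  rw [sub_eq_neg_add, gen_zpow_add_smul, zpow_neg, inv_smul_eq_iff]

theorem IsMinimal.exists_zpow_mem (hT : IsMinimal T) (x : X) {U : Set X} (hU : IsOpen U)
    (hne : U.Nonempty) : ∃ n : ℤ, gen T ^ n • x ∈ U := by
  obtain ⟨_, hy, n, rfl⟩ := (hT x).inter_open_nonempty U hU hne
  exact ⟨n, by rwa [gen_zpow_smul]⟩

/-- A minimal homeomorphism with a periodic point is a finite cycle. -/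
theorem IsMinimal.exists_lt_of_periodic [T2Space X] (hT : IsMinimal T) {x : X} {p : ℕ}
    (hp : 0 < p) (hx : gen T ^ (p : ℤ) • x = x) (y : X) :
    ∃ j : ℕ, j < p ∧ gen T ^ (j : ℤ) • x = y := by
  have hmul : ∀ k : ℤ, gen T ^ ((p : ℤ) * k) • x = x := fun k => by
    have hs : gen T ^ (p : ℤ) ∈ MulAction.stabilizer (topologicalFullGroup T) x := hx
    rw [zpow_mul]
    exact (MulAction.stabilizer (topologicalFullGroup T) x).zpow_mem hs k
  have hmod (n : ℤ) : gen T ^ n • x = gen T ^ (n % p) • x := by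
    conv_lhs => rw [← Int.emod_add_mul_ediv n p, gen_zpow_add_smul, hmul]
  have hfin : (Set.range fun n : ℤ => (T ^ n) x).Finite := by
    refine ((Set.finite_Iio p).image fun j : ℕ => gen T ^ (j : ℤ) • x).subset ?_
    rintro _ ⟨n, rfl⟩
    refine ⟨(n % p).toNat, ?_, ?_⟩
    · have := Int.emod_lt_of_pos n (show (0 : ℤ) < p by omega)
      simp only [Set.mem_Iio]; omega
    · simp only []
      rw [Int.toNat_of_nonneg (Int.emod_nonneg _ (by omega)), ← hmod, gen_zpow_smul]
  have hu : y ∈ Set.range fun n : ℤ => (T ^ n) x := by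
    have := (hT x).closure_eq
    rw [hfin.isClosed.closure_eq] at this
    rw [this]; trivial
  obtain ⟨n, rfl⟩ := hu
  refine ⟨(n % p).toNat, ?_, ?_⟩
  · have := Int.emod_lt_of_pos n (show (0 : ℤ) < p by omega)
    omega
  · rw [Int.toNat_of_nonneg (Int.emod_nonneg _ (by omega)), ← hmod, gen_zpow_smul]

theorem IsMinimal.finite_of_periodic [T2Space X] (hT : IsMinimal T) {x : X} {n : ℤ}
    (hn : n ≠ 0) (hx : gen T ^ n • x = x) : Finite X := by
  have hx' : gen T ^ (n.natAbs : ℤ) • x = x := by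
    rcases abs_choice n with h | h <;> rw [Int.natCast_natAbs, h]
    · exact hx
    · rw [zpow_neg, inv_smul_eq_iff, hx]
  refine Set.finite_univ_iff.1 (((Set.finite_Iio n.natAbs).image
    fun j : ℕ => gen T ^ (j : ℤ) • x).subset fun y _ => ?_)
  obtain ⟨j, hj, e⟩ := hT.exists_lt_of_periodic (by omega) hx' y
  exact ⟨j, hj, e⟩

variable (T) in
/-- The family `T^m, …, T^(m+n)`. -/
def segment (m : ℤ) (n : ℕ) (j : Fin (n + 1)) : topologicalFullGroup T := gen T ^ (m + (j : ℕ))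

/-- Three consecutive levels of a segment form a tower `1, T, T²` over the translated base `T^(m+k)
W`, and so carry a `σ`. -/
theorem segment_comp_isTower {m : ℤ} {n : ℕ} {W : Set X} (h : IsTower (segment T m n) W)
    {k : ℕ} (hk : k + 2 < n + 1) :
    IsTower (genPow T) {x | (gen T ^ (m + k))⁻¹ • x ∈ W} := by
  refine ⟨isClopen_preimage_smul _ h.isClopen, fun i j v hv w hw e => ?_⟩
  have := h.index_eq ⟨k + i, by omega⟩ ⟨k + j, by omega⟩ _ hv _ hw (by
    simp only [segment, ← mul_smul, ← zpow_neg, ← zpow_add]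
    convert e using 2 <;>
    · rw [genPow, ← zpow_natCast]; congr 1; push_cast; ring)
  simpa [Fin.ext_iff] using this

theorem exists_clopen_eq_zpow {ι : Type*} [Finite ι] (g : ι → topologicalFullGroup T) (x : X) :
    ∃ a : ι → ℤ, ∃ N, IsClopen N ∧ x ∈ N ∧ ∀ i, ∀ w ∈ N, g i • w = gen T ^ a i • w := by
  choose f hf hfx using fun i => exists_cocycle (g i)
  refine ⟨fun i => f i x, ⋂ i, f i ⁻¹' {f i x},
    isClopen_iInter_of_finite fun i => (isClopen_discrete _).preimage (hf i), by simp,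
    fun i w hw => ?_⟩
  rw [hfx i w, Set.mem_iInter.1 hw i]

variable [CompactSpace X] [T2Space X] [TotallyDisconnectedSpace X]

/-- Locally, finitely many elements of the full group act along a tower of powers of `T`. -/
theorem exists_segment (hT : IsMinimal T) {ι : Type*} [Finite ι]
    (g : ι → topologicalFullGroup T) (x : X) :
    ∃ N, IsClopen N ∧ x ∈ N ∧ ∃ (m : ℤ) (n : ℕ) (e : ι → Fin (n + 1)),
      ∀ W ⊆ N, IsClopen W → IsTower (segment T m n) W ∧
        ∀ i, ∀ w ∈ W, g i • w = segment T m n (e i) • w := by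
  obtain ⟨a, N₀, hN₀, hx₀, ha⟩ := exists_clopen_eq_zpow g x
  by_cases hper : ∃ p : ℕ, 0 < p ∧ gen T ^ (p : ℤ) • x = x
  -- Periodic case: `X` is a single cycle of minimal length `p`, and the `p` powers `T^0, …,
  -- T^(p-1)` form a tower over `{x}`.
  · classical
    let p := Nat.find hper
    obtain ⟨hp, hpx⟩ := Nat.find_spec hper
    change 0 < p at hp
    change gen T ^ (p : ℤ) • x = x at hpx
    have : Finite X := hT.finite_of_periodic (n := p) (by omega) hpx
    choose j hj hjx using fun i => hT.exists_lt_of_periodic hp hpx (g i • x)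
    refine ⟨{x}, isClopen_discrete _, rfl, 0, p - 1, fun i => ⟨j i, by have := hj i; omega⟩,
      fun W hW hWc => ⟨⟨hWc, ?_⟩, ?_⟩⟩
    · have key : ∀ i j : Fin (p - 1 + 1), i < j →
          segment T 0 (p - 1) i • x ≠ segment T 0 (p - 1) j • x := by
        intro i j hij e
        refine Nat.find_min hper (m := j - i) (show (j : ℕ) - i < p by omega) ⟨by omega, ?_⟩
        rw [segment, segment, eq_comm, gen_zpow_smul_eq_iff] at e
        conv_rhs => rw [← e]
        congr 2
        push_cast [Nat.cast_sub (show (i : ℕ) ≤ j from hij.le)]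
        ring
      intro i j v hv w hw e
      rw [hW hv, hW hw] at e
      rcases lt_trichotomy i j with h | h | h
      · exact (key i j h e).elim
      · exact h
      · exact (key j i h e.symm).elim
    · intro i w hw
      rw [hW hw, ← hjx i]
      simp [segment]
  · have hfree : ∀ d : ℕ, 0 < d → gen T ^ (d : ℤ) • x ≠ x := fun d hd e => hper ⟨d, hd, e⟩
    -- All exponents lie in `[-K, K]`. A neighbourhood disjoint from its images under `T^d`, `1 ≤ d
    -- ≤ 2K`, makes `T^(-K), …, T^K` a tower; the exponent `a i` is the level `a i + K`.
    obtain ⟨K, hK⟩ : ∃ K : ℕ, ∀ i, (a i).natAbs ≤ K := by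
      obtain ⟨K, hK⟩ := (Set.finite_range fun i => (a i).natAbs).bddAbove
      exact ⟨K, fun i => hK ⟨i, rfl⟩⟩
    choose M hM hxM hMd using fun d : Fin (2 * K) => exists_clopen_disjoint
      (continuous_smul_left (gen T ^ (((d : ℕ) + 1 : ℕ) : ℤ))) (hfree (d + 1) (by omega))
    refine ⟨N₀ ∩ ⋂ d, M d, hN₀.inter (isClopen_iInter_of_finite hM), ⟨hx₀, by simpa using hxM⟩,
      -K, 2 * K, fun i => ⟨(a i + K).toNat, by have := hK i; omega⟩,
      fun W hW hWc => ⟨⟨hWc, ?_⟩, ?_⟩⟩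
    · have key : ∀ i j : Fin (2 * K + 1), i < j → ∀ v ∈ W, ∀ w ∈ W,
          segment T (-K) (2 * K) j • v ≠ segment T (-K) (2 * K) i • w := by
        intro i j hij v hv w hw e
        rw [segment, segment, gen_zpow_smul_eq_iff] at e
        let d : Fin (2 * K) := ⟨j - i - 1, by omega⟩
        refine hMd d v (Set.mem_iInter.1 (hW hv).2 d) ?_
        have : (-(K : ℤ) + (j : ℕ) - (-(K : ℤ) + (i : ℕ))) = (((d : ℕ) + 1 : ℕ) : ℤ) := by
          simp only [d]
          have : (i : ℕ) < j := hij
          omega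
        rw [this] at e
        change gen T ^ (((d : ℕ) + 1 : ℕ) : ℤ) • v ∈ _
        rw [e]
        exact Set.mem_iInter.1 (hW hw).2 d
      intro i j v hv w hw e
      rcases lt_trichotomy i j with h | h | h
      · exact (key i j h w hw v hv e.symm).elim
      · exact h
      · exact (key j i h v hv w hw e).elim
    · intro i w hw
      rw [ha i w (hW hw).1, segment]
      congr 2
      have := hK i
      simp only []
      omega

end Local

end FullGroup

/-! ### The subgroup generated by the elements `σ_U` -/

namespace FullGroup

section Even

variable {X : Type*} [TopologicalSpace X] {T : X ≃ₜ X}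

/-- The base may be translated by `k` at the cost of multiplying the family by `k` on the right. -/
theorem IsTower.rho_translate {ι : Type*} [Finite ι] {g : ι → topologicalFullGroup T} {W : Set X}
    {k : topologicalFullGroup T} (h : IsTower g {x | k⁻¹ • x ∈ W})
    (h' : IsTower (fun i => g i * k) W) (π : Equiv.Perm ι) : h.rho π = h'.rho π := by
  refine h'.rho_unique π (fun i w hw => ?_) fun x hx => ?_
  · rw [mul_smul, mul_smul, h.rho_smul π i (by simpa using hw)]
  · refine h.rho_smul_of_notMem π fun i w hw e => hx i _ hw ?_
    rw [mul_smul, smul_inv_smul, e]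

/-- The product `(i i+1)(i+1 i+2)` is a 3-cycle on consecutive levels, hence the `σ` of the base
`T^(m+i) W`. Such products generate the even permutations. -/
theorem IsTower.rho_segment_mem {H : Subgroup (topologicalFullGroup T)}
    (hH : ∀ U (h : IsThreeTower T U), sigma T U h ∈ H) {m : ℤ} {n : ℕ} {W : Set X}
    (h : IsTower (segment T m n) W) {π : Equiv.Perm (Fin (n + 1))}
    (hπ : Equiv.Perm.sign π = 1) : h.rho π ∈ H := by
  refine Equiv.Perm.mem_of_sign_eq_one (H.comap h.rho) (fun i j hij => ?_) π hπ
  have hlt : (i : ℕ) + 2 < n + 1 := by omega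
  have ht := segment_comp_isTower h hlt
  let e : Fin 3 ↪ Fin (n + 1) := ⟨fun k => ⟨i + k, by omega⟩, fun k l hkl => by
    simpa [Fin.ext_iff] using hkl⟩
  have he : ∀ k, (e k : ℕ) = i + k := fun _ => rfl
  have hfam : (fun k : Fin 3 => segment T m n (e k)) =
      fun k => genPow T k * gen T ^ (m + ((i : ℕ) : ℤ)) := by
    funext k
    rw [segment, genPow, ← zpow_natCast, ← zpow_add]
    congr 1
    rw [he]
    push_cast
    ring
  have h3 := h.comp e
  have hp : (finRotate 3).viaFintypeEmbedding e =
      Equiv.swap i.castSucc i.succ * Equiv.swap j.castSucc j.succ := by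
    have e0 : i.castSucc = e 0 := by ext; simp [he]
    have e1 : i.succ = e 1 := by ext; simp [he]
    have e1' : j.castSucc = e 1 := by ext; simp [he, hij]
    have e2 : j.succ = e 2 := by ext; simp [he, ← hij]
    rw [e0, e1, e1', e2]
    ext1 l
    by_cases hl : l ∈ Set.range e
    · obtain ⟨k, rfl⟩ := hl
      rw [Equiv.Perm.viaFintypeEmbedding_apply_image, Equiv.Perm.mul_apply,
        e.swap_apply, e.swap_apply]
      congr 1
      revert k
      decide
    · rw [Equiv.Perm.viaFintypeEmbedding_apply_notMem_range _ _ hl, Equiv.Perm.mul_apply,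
        Equiv.swap_apply_of_ne_of_ne (a := e 1), Equiv.swap_apply_of_ne_of_ne] <;>
      · rintro rfl
        exact hl ⟨_, rfl⟩
  have : sigma T _ ht.isThreeTower = h.rho
      (Equiv.swap i.castSucc i.succ * Equiv.swap j.castSucc j.succ) := by
    rw [sigma_eq_rho, ← hp, ← h.rho_comp e]
    refine (ht.rho_translate (hfam ▸ h3) _).trans ?_
    refine IsTower.rho_congr _ _ (fun k w _ => ?_) _
    exact congrArg (· • w) (congrFun hfam k).symm
  exact Subgroup.mem_comap.2 (this ▸ hH _ _)

variable [CompactSpace X] [T2Space X] [TotallyDisconnectedSpace X]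

/-- Over a small base the tower embeds in a segment, and extending a permutation by the identity
preserves its sign. -/
theorem IsTower.rho_mem (hT : IsMinimal T) {H : Subgroup (topologicalFullGroup T)}
    (hH : ∀ U (h : IsThreeTower T U), sigma T U h ∈ H) {ι : Type*} [Fintype ι] [DecidableEq ι]
    {g : ι → topologicalFullGroup T} {W : Set X} (h : IsTower g W) {π : Equiv.Perm ι}
    (hπ : Equiv.Perm.sign π = 1) : h.rho π ∈ H := by
  refine clopen_induction (P := fun W => ∀ h : IsTower g W, h.rho π ∈ H)
    (fun h => by rw [h.rho_eq_one_of_empty]; exact H.one_mem) ?_ (fun x => ?_) h.isClopen h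
  · intro U V hU hV hd ihU ihV h
    rw [h.rho_union (h.mono hU Set.subset_union_left) (h.mono hV Set.subset_union_right) hd]
    exact H.mul_mem (ihU _) (ihV _)
  · obtain ⟨N, hN, hx, m, n, e, he⟩ := exists_segment hT g x
    refine ⟨N, hN, hx, fun W hWN hW h => ?_⟩
    obtain ⟨hs, hg⟩ := he W hWN hW
    obtain rfl | ⟨w, hw⟩ := W.eq_empty_or_nonempty
    · rw [h.rho_eq_one_of_empty]; exact H.one_mem
    have hinj : Function.Injective e := fun i j hij =>
      h.index_eq i j w hw w hw (by rw [hg i w hw, hg j w hw, hij])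
    rw [h.rho_congr (hs.comp ⟨e, hinj⟩) hg, hs.rho_comp]
    exact hs.rho_segment_mem hH (by rw [Equiv.Perm.viaFintypeEmbedding_sign, hπ])

variable (T) in
/-- The subgroup generated by all the elements `σ_U`. -/
def sigmaSubgroup : Subgroup (topologicalFullGroup T) :=
  Subgroup.closure {s | ∃ U, ∃ h : IsThreeTower T U, s = sigma T U h}

omit [CompactSpace X] [T2Space X] [TotallyDisconnectedSpace X] in
theorem sigma_mem_sigmaSubgroup (U : Set X) (h : IsThreeTower T U) :
    sigma T U h ∈ sigmaSubgroup T :=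
  Subgroup.subset_closure ⟨U, h, rfl⟩

/-- A conjugate of `σ_U` is a 3-cycle on the tower `k, kT, kT²` over `U`, hence an even permutation
of a tower. -/
theorem sigmaSubgroup_normal (hT : IsMinimal T) : (sigmaSubgroup T).Normal := by
  refine ⟨fun s hs k => ?_⟩
  suffices h : sigmaSubgroup T ≤ (sigmaSubgroup T).comap (MulAut.conj k).toMonoidHom from h hs
  refine (Subgroup.closure_le _).2 ?_
  rintro _ ⟨U, h, rfl⟩
  change k * sigma T U h * k⁻¹ ∈ sigmaSubgroup T
  rw [sigma_eq_rho, ← h.isTower.rho_conj]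
  exact IsTower.rho_mem hT sigma_mem_sigmaSubgroup _ (by decide)

/-- Exchanging two levels of a tower is central modulo the elements `σ_U`. -/
theorem IsTower.rho_swap_commutator_mem (hT : IsMinimal T) {g : Fin 2 → topologicalFullGroup T}
    {W : Set X} (h : IsTower g W) (k : topologicalFullGroup T) :
    k * h.rho (Equiv.swap 0 1) * k⁻¹ * (h.rho (Equiv.swap 0 1))⁻¹ ∈ sigmaSubgroup T := by
  have hN := sigmaSubgroup_normal hT
  refine clopen_induction (P := fun W => ∀ h : IsTower g W,
    k * h.rho (Equiv.swap 0 1) * k⁻¹ * (h.rho (Equiv.swap 0 1))⁻¹ ∈ sigmaSubgroup T)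
    (fun h => by simp [h.rho_eq_one_of_empty]) ?_ (fun x => ?_) h.isClopen h
  · intro U V hU hV hd ihU ihV h
    have hU' := h.mono hU Set.subset_union_left
    have hV' := h.mono hV Set.subset_union_right
    rw [h.rho_union hU' hV' hd]
    -- This is the identity `[k, ab] = [k, a] · a [k, b] a⁻¹`, combined with normality.
    convert Subgroup.mul_mem _ (ihU hU')
      (hN.conj_mem _ (ihV hV') (hU'.rho (Equiv.swap 0 1))) using 1
    group
  -- The families `g` and `k * g` are placed in one segment although their levels may overlap; both
  -- swaps become transpositions there, and the product of two transpositions is even.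
  · obtain ⟨N, hN, hx, m, n, e, he⟩ :=
      exists_segment hT (Sum.elim g fun i => k * g i) x
    refine ⟨N, hN, hx, fun W hWN hW h => ?_⟩
    obtain ⟨hs, hg⟩ := he W hWN hW
    obtain rfl | ⟨w, hw⟩ := W.eq_empty_or_nonempty
    · simp [h.rho_eq_one_of_empty]
    have hg1 : ∀ i, ∀ w ∈ W, g i • w = segment T m n (e (.inl i)) • w := fun i => hg (.inl i)
    have hg2 : ∀ i, ∀ w ∈ W, (k * g i) • w = segment T m n (e (.inr i)) • w := fun i => hg (.inr i)
    have i1 : Function.Injective fun i => e (.inl i) := fun i j (hij : e _ = e _) =>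
      h.index_eq i j w hw w hw (by rw [hg1 i w hw, hg1 j w hw, hij])
    have i2 : Function.Injective fun i => e (.inr i) := fun i j (hij : e _ = e _) =>
      (h.conj k).index_eq i j w hw w hw (by rw [hg2 i w hw, hg2 j w hw, hij])
    rw [← h.rho_conj, h.rho_congr (hs.comp ⟨_, i1⟩) hg1, (h.conj k).rho_congr (hs.comp ⟨_, i2⟩) hg2,
      hs.rho_comp, hs.rho_comp, ← map_inv, ← map_mul]
    refine hs.rho_mem hT sigma_mem_sigmaSubgroup ?_
    rw [Equiv.Perm.sign_mul, Equiv.Perm.sign_inv, Equiv.Perm.viaFintypeEmbedding_sign,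
      Equiv.Perm.viaFintypeEmbedding_sign]
    decide

end Even
end FullGroup

/-! ### Generation of the topological full group by `T` and exchanges of levels -/

namespace FullGroup

section Induced

variable {X : Type*} [TopologicalSpace X] {T : X ≃ₜ X}

/-- `R` is the first return map of `V`, extended by the identity. -/
structure IsInduced (V : Set X) (R : topologicalFullGroup T) : Prop where
  smul_eq : ∀ x, x ∉ V → R • x = x
  smul_mem : ∀ x ∈ V, R • x ∈ V
  exists_return : ∀ x ∈ V, ∃ r : ℕ, 0 < r ∧ R • x = gen T ^ r • x ∧
    ∀ j : ℕ, 0 < j → j < r → gen T ^ j • x ∉ V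

theorem isInduced_univ : IsInduced Set.univ (gen T) :=
  ⟨fun x hx => (hx trivial).elim, fun _ _ => trivial,
    fun x _ => ⟨1, one_pos, by simp, fun j _ _ => by omega⟩⟩

/-- Removing from `V` a clopen set `W` disjoint from its preimage under the return map. -/
theorem IsInduced.sdiff {V W : Set X} {R : topologicalFullGroup T} (hR : IsInduced V R)
    (hWV : W ⊆ V) (h : IsTower ![1, R⁻¹] W) :
    IsInduced (V \ W) (R * h.rho (Equiv.swap 0 1)) := by
  -- The swap exchanges `W` with `R⁻¹W`. Following it by `R` fixes `W` pointwise and makes a point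
  -- about to enter `W` return one step later.
  have hd : ∀ w ∈ W, R • w ∉ W := fun w hw hw' =>
    absurd (h.index_eq 0 1 w hw _ hw' (by simp)) (by decide)
  have s0 : ∀ w ∈ W, h.rho (Equiv.swap 0 1) • w = R⁻¹ • w := fun w hw => by
    simpa using h.rho_smul (Equiv.swap 0 1) 0 hw
  have s1 : ∀ x, R • x ∈ W → h.rho (Equiv.swap 0 1) • x = R • x := fun x hx => by
    simpa using h.rho_smul (Equiv.swap 0 1) 1 hx
  have s2 : ∀ x, x ∉ W → R • x ∉ W → h.rho (Equiv.swap 0 1) • x = x := fun x h1 h2 => by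
    refine h.rho_smul_of_notMem _ fun i w hw e => ?_
    fin_cases i
    · exact h1 (by simpa [← e] using hw)
    · refine h2 ?_
      rw [← e]
      simpa using hw
  refine ⟨fun x hx => ?_, fun x hx => ?_, fun x hx => ?_⟩
  · rw [mul_smul]
    by_cases hxW : x ∈ W
    · rw [s0 x hxW, smul_inv_smul]
    · have hxV : x ∉ V := fun h' => hx ⟨h', hxW⟩
      have e := hR.smul_eq x hxV
      rw [s2 x hxW (by rwa [e]), e]
  · rw [mul_smul]
    by_cases hxW : R • x ∈ W
    · rw [s1 x hxW]
      exact ⟨hR.smul_mem _ (hWV hxW), hd _ hxW⟩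
    · rw [s2 x hx.2 hxW]
      exact ⟨hR.smul_mem x hx.1, hxW⟩
  · obtain ⟨r, hr, e, hmin⟩ := hR.exists_return x hx.1
    rw [mul_smul]
    by_cases hxW : R • x ∈ W
    · rw [s1 x hxW]
      obtain ⟨r', hr', e', hmin'⟩ := hR.exists_return _ (hWV hxW)
      refine ⟨r' + r, by omega, by rw [e', e, pow_add, mul_smul], fun j hj hjr hmem => ?_⟩
      rcases lt_trichotomy j r with hlt | rfl | hlt
      · exact hmin j hj hlt hmem.1
      · exact hmem.2 (e ▸ hxW)
      · refine hmin' (j - r) (by omega) (by omega) ?_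
        rw [e, ← mul_smul, ← pow_add, Nat.sub_add_cancel hlt.le]
        exact hmem.1
    · rw [s2 x hx.2 hxW]
      exact ⟨r, hr, e, fun j hj hjr hmem => hmin j hj hjr hmem.1⟩

theorem isTower_of_disjoint {W : Set X} (hW : IsClopen W) {R : topologicalFullGroup T}
    (h : ∀ w ∈ W, R • w ∉ W) : IsTower ![1, R⁻¹] W := by
  have key : ∀ v ∈ W, ∀ w ∈ W, v ≠ R⁻¹ • w := by
    rintro v hv w hw rfl
    exact h _ hv (by simpa using hw)
  refine ⟨hW, fun i j v hv w hw e => ?_⟩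
  fin_cases i <;> fin_cases j
  · rfl
  · exact (key v hv w hw (by simpa using e)).elim
  · exact (key w hw v hv (by simpa using e.symm)).elim
  · rfl

/-- Without periodic points `g` moves exactly the points where its cocycle is nonzero; with one, the
space is finite. -/
theorem IsMinimal.isClopen_moved [T2Space X] (hT : IsMinimal T) (g : topologicalFullGroup T) :
    IsClopen {x : X | g • x ≠ x} := by
  by_cases hper : ∃ (x : X) (n : ℤ), n ≠ 0 ∧ gen T ^ n • x = x
  · obtain ⟨x, n, hn, hx⟩ := hper
    have := hT.finite_of_periodic hn hx
    exact isClopen_discrete _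
  · push Not at hper
    obtain ⟨f, hf, hfx⟩ := exists_cocycle g
    have : {x : X | g • x ≠ x} = f ⁻¹' {0}ᶜ := by
      ext x
      refine ⟨fun h h' => h ?_, fun h h' => hper x (f x) h (by rw [← hfx, h'])⟩
      rw [hfx, show f x = 0 from h']
      simp
    rw [this]
    exact (isClopen_discrete _).preimage hf

variable [CompactSpace X]

/-- Compactness bounds the hitting times of `U` in absolute value by some `M`; starting from `T^M x`
makes the total time positive. -/
theorem IsMinimal.exists_pow_mem (hT : IsMinimal T) (x : X) {U : Set X} (hU : IsOpen U)
    (hne : U.Nonempty) : ∃ n : ℕ, 0 < n ∧ gen T ^ n • x ∈ U := by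
  obtain ⟨t, ht⟩ := isCompact_univ.elim_finite_subcover (fun n : ℤ => {y : X | gen T ^ n • y ∈ U})
    (fun n => hU.preimage (continuous_smul_left _))
    fun y _ => Set.mem_iUnion.2 (hT.exists_zpow_mem y hU hne)
  obtain ⟨M, hM⟩ : ∃ M : ℕ, ∀ n ∈ t, n.natAbs < M :=
    ⟨t.sup Int.natAbs + 1, fun n hn => Nat.lt_succ_of_le (Finset.le_sup (f := Int.natAbs) hn)⟩
  obtain ⟨n, hn, hmem⟩ := Set.mem_iUnion₂.1 (ht (Set.mem_univ (gen T ^ (M : ℤ) • x)))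
  have := hM n hn
  refine ⟨(n + M).toNat, by omega, ?_⟩
  rw [← zpow_natCast, Int.toNat_of_nonneg (by omega), gen_zpow_add_smul]
  exact hmem

variable [T2Space X] [TotallyDisconnectedSpace X] {K : Subgroup (topologicalFullGroup T)}

/-- A subgroup that contains `T` and all exchanges of levels contains the first return map of
every nonempty clopen set. -/
theorem IsMinimal.exists_isInduced (hT : IsMinimal T) (hgen : gen T ∈ K)
    (hswap : ∀ (g : Fin 2 → topologicalFullGroup T) (W : Set X) (h : IsTower g W),
      h.rho (Equiv.swap 0 1) ∈ K) {U : Set X} (hU : IsClopen U) (hne : U.Nonempty) :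
    ∃ R ∈ K, IsInduced U R := by
  -- Quantifying over the current set `V` lets the pieces of `Uᶜ` be removed one after another,
  -- starting from the whole space.
  have key := clopen_induction (P := fun W : Set X => ∀ V, U ⊆ V → W ⊆ V → Disjoint W U →
    (∃ R ∈ K, IsInduced V R) → ∃ R ∈ K, IsInduced (V \ W) R)
    (fun V _ _ _ h => by simpa using h) ?_ ?_ hU.compl Set.univ (Set.subset_univ _)
    (Set.subset_univ _) disjoint_compl_left ⟨_, hgen, isInduced_univ⟩
  · have e : Set.univ \ Uᶜ = U := by rw [← Set.compl_eq_univ_sdiff, compl_compl]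
    rwa [e] at key
  · intro W₁ W₂ _ _ hd h₁ h₂ V hUV hWV hWU hR
    rw [← Set.sdiff_sdiff]
    rw [Set.disjoint_union_left] at hWU
    refine h₂ _ (fun u hu => ⟨hUV hu, fun h => Set.disjoint_left.1 hWU.1 h hu⟩)
      (fun w hw => ⟨hWV (.inr hw), fun h => Set.disjoint_left.1 hd h hw⟩) hWU.2
      (h₁ V hUV (Set.subset_union_left.trans hWV) hWU.1 hR)
  · intro x
    classical
    by_cases hxU : x ∈ U
    · refine ⟨U, hU, hxU, fun W hWU _ V _ _ hd hR => ?_⟩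
      obtain rfl : W = ∅ := disjoint_self.1 (hd.mono_right hWU)
      simpa using hR
    -- Let `k` be the first time `x` reaches `U`. A period at most `k` would give an earlier visit,
    -- so some neighbourhood of `x` is disjoint from its images under `T, …, T^k`. Nearby points
    -- return to `V ⊇ U` within `k` steps, hence outside `W`.
    · have hex := hT.exists_pow_mem x hU.isOpen hne
      let k := Nat.find hex
      obtain ⟨hk, hkU⟩ : 0 < k ∧ gen T ^ k • x ∈ U := Nat.find_spec hex
      have hne : ∀ d : Fin k, gen T ^ (d + 1 : ℕ) • x ≠ x := fun d e => by
        have h1 : gen T ^ (k - (d + 1)) • x ∈ U := by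
          have : gen T ^ k • x = gen T ^ (k - (d + 1)) • gen T ^ (d + 1 : ℕ) • x := by
            rw [← mul_smul, ← pow_add, Nat.sub_add_cancel (by omega)]
          rwa [this, e] at hkU
        rcases (k - (d + 1)).eq_zero_or_pos with h0 | h0
        · rw [h0, pow_zero, one_smul] at h1
          exact hxU h1
        · exact Nat.find_min hex (show k - (d + 1) < k by omega) ⟨h0, h1⟩
      choose M hM hxM hMd using fun d : Fin k =>
        exists_clopen_disjoint (continuous_smul_left (gen T ^ (d + 1 : ℕ))) (hne d)
      refine ⟨{y | gen T ^ k • y ∈ U} ∩ ⋂ d, M d,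
        (isClopen_preimage_smul _ hU).inter (isClopen_iInter_of_finite hM),
        ⟨hkU, by simpa using hxM⟩, ?_⟩
      rintro W hWN hW V hUV hWV - ⟨R, hRK, hR⟩
      have hd : ∀ w ∈ W, R • w ∉ W := fun w hw hw' => by
        obtain ⟨r, hr, e, hmin⟩ := hR.exists_return w (hWV hw)
        have hrk : r ≤ k := by
          by_contra! hlt
          exact hmin k hk hlt (hUV (hWN hw).1)
        let d : Fin k := ⟨r - 1, by omega⟩
        have hdr : (d + 1 : ℕ) = r := by simp only [d]; omega
        have := hMd d w (Set.mem_iInter.1 (hWN hw).2 d)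
        rw [hdr, ← e] at this
        exact this (Set.mem_iInter.1 (hWN hw').2 d)
      exact ⟨_, K.mul_mem hRK (hswap _ _ (isTower_of_disjoint hW hd)), hR.sdiff hWV _⟩

/-- Let `R` be the first return map of the moved set of `g`. A moved point stays in that set under
`g`, so `g` jumps at least as far as `R`, and the exponents of `g * R⁻¹` lie in `[0, m]` when those
of `g` lie in `[0, m+1]`. -/
theorem IsMinimal.mem_of_forall_exists_pow (hT : IsMinimal T) (hgen : gen T ∈ K)
    (hswap : ∀ (g : Fin 2 → topologicalFullGroup T) (W : Set X) (h : IsTower g W),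
      h.rho (Equiv.swap 0 1) ∈ K) (m : ℕ) :
    ∀ g : topologicalFullGroup T, (∀ x : X, ∃ k : ℕ, k ≤ m ∧ g • x = gen T ^ k • x) → g ∈ K := by
  have hone : ∀ g : topologicalFullGroup T, (∀ x : X, g • x = x) → g ∈ K := fun g hg => by
    have : g = 1 := eq_of_smul_eq_smul (α := X) fun x => by rw [hg, one_smul]
    exact this ▸ K.one_mem
  induction m with
  | zero =>
    intro g hg
    refine hone g fun x => ?_
    obtain ⟨k, hk, e⟩ := hg x
    rw [e, Nat.le_zero.1 hk, pow_zero, one_smul]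
  | succ m ih =>
    intro g hg
    obtain hU | hU := Set.eq_empty_or_nonempty {x : X | g • x ≠ x}
    · exact hone g fun x => by
        by_contra h
        exact (hU ▸ (show x ∈ {x : X | g • x ≠ x} from h) : x ∈ (∅ : Set X))
    obtain ⟨R, hRK, hR⟩ := hT.exists_isInduced hgen hswap (hT.isClopen_moved g) hU
    suffices h : g * R⁻¹ ∈ K by simpa using K.mul_mem h hRK
    refine ih _ fun y => ?_
    obtain ⟨x, rfl⟩ : ∃ x, R • x = y := ⟨R⁻¹ • y, by simp⟩
    rw [mul_smul, inv_smul_smul]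
    by_cases hx : g • x = x
    · exact ⟨0, by omega, by rw [hR.smul_eq x (by simpa using hx), hx, pow_zero, one_smul]⟩
    · obtain ⟨r, hr, e, hmin⟩ := hR.exists_return x hx
      obtain ⟨k, hk, e'⟩ := hg x
      have hk0 : 0 < k := by
        refine Nat.pos_of_ne_zero fun h0 => hx ?_
        rw [e', h0, pow_zero, one_smul]
      have hrk : r ≤ k := by
        by_contra! hlt
        refine hmin k hk0 hlt ?_
        rw [← e']
        simpa using hx
      exact ⟨k - r, by omega, by rw [e, e', ← mul_smul, ← pow_add, Nat.sub_add_cancel hrk]⟩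

theorem IsMinimal.eq_top (hT : IsMinimal T) (hgen : gen T ∈ K)
    (hswap : ∀ (g : Fin 2 → topologicalFullGroup T) (W : Set X) (h : IsTower g W),
      h.rho (Equiv.swap 0 1) ∈ K) : K = ⊤ := by
  refine (Subgroup.eq_top_iff' K).2 fun g => ?_
  obtain ⟨f, hf, hfx⟩ := exists_cocycle g
  obtain ⟨M, hM⟩ : ∃ M : ℕ, ∀ x, (f x).natAbs ≤ M := by
    have hfin : (Set.range f).Finite := (isCompact_range hf).finite_of_discrete
    obtain ⟨M, hM⟩ := (hfin.image Int.natAbs).bddAbove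
    exact ⟨M, fun x => hM ⟨_, ⟨x, rfl⟩, rfl⟩⟩
  -- Multiplying by `T^M` moves the exponents from `[-M, M]` to `[0, 2M]`.
  suffices h : gen T ^ M * g ∈ K by
    simpa using K.mul_mem (K.inv_mem (K.pow_mem hgen M)) h
  refine hT.mem_of_forall_exists_pow hgen hswap (2 * M) _ fun x => ?_
  have := hM x
  refine ⟨(M + f x).toNat, by omega, ?_⟩
  rw [mul_smul, hfx, ← zpow_natCast, ← zpow_natCast, ← gen_zpow_add_smul,
    Int.toNat_of_nonneg (by omega)]

theorem IsMinimal.commutator_le (hT : IsMinimal T) :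
    commutator (topologicalFullGroup T) ≤ sigmaSubgroup T := by
  have hN := sigmaSubgroup_normal hT
  let q := QuotientGroup.mk' (sigmaSubgroup T)
  have hcentral : ∀ (g : Fin 2 → topologicalFullGroup T) (W : Set X) (h : IsTower g W),
      h.rho (Equiv.swap 0 1) ∈ (Subgroup.center _).comap q := by
    intro g W h
    rw [Subgroup.mem_comap, Subgroup.mem_center_iff]
    intro y
    obtain ⟨k, rfl⟩ := QuotientGroup.mk'_surjective _ y
    have := (QuotientGroup.eq_one_iff _).2 (h.rho_swap_commutator_mem hT k)
    change q _ = 1 at this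
    rwa [map_mul, mul_eq_one_iff_eq_inv, map_inv, inv_inv, map_mul, map_mul, map_inv,
      mul_inv_eq_iff_eq_mul] at this
  -- Generation is used twice: `T` commutes with itself and with the central swaps, so its image is
  -- central; then all generators have central image.
  have h1 : (Subgroup.centralizer {q (gen T)}).comap q = ⊤ :=
    hT.eq_top (by simp [Subgroup.mem_centralizer_singleton_iff]) fun g W h =>
      Subgroup.comap_mono (Subgroup.center_le_centralizer _) (hcentral g W h)
  have h2 : (Subgroup.center _).comap q = ⊤ := by
    refine hT.eq_top ?_ hcentral
    rw [Subgroup.mem_comap, Subgroup.mem_center_iff]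
    intro y
    obtain ⟨k, rfl⟩ := QuotientGroup.mk'_surjective _ y
    have : k ∈ (Subgroup.centralizer {q (gen T)}).comap q := h1 ▸ Subgroup.mem_top k
    exact Subgroup.mem_centralizer_singleton_iff.1 this
  refine Subgroup.Normal.quotient_commutative_iff_commutator_le.1 ⟨⟨fun a b => ?_⟩⟩
  obtain ⟨k, rfl⟩ := QuotientGroup.mk'_surjective _ b
  have : k ∈ (Subgroup.center _).comap q := h2 ▸ Subgroup.mem_top k
  exact Subgroup.mem_center_iff.1 this a

end Induced

/-! ### The elements `σ_U` as commutators. -/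

section SigmaCommutator

open scoped commutatorElement

variable {X : Type*} [TopologicalSpace X] {T : X ≃ₜ X}

theorem sigma_mem_commutator {U : Set X} (h : IsThreeTower T U) :
    sigma T U h ∈ commutator (topologicalFullGroup T) := by
  rw [sigma_eq_rho, show finRotate 3 = ⁅Equiv.swap (1 : Fin 3) 2, Equiv.swap 0 1⁆ by decide,
    map_commutatorElement]
  exact Subgroup.commutator_mem_commutator (Subgroup.mem_top _) (Subgroup.mem_top _)

end SigmaCommutator
end FullGroup

/-! ### Cylinder sets and the generators -/

namespace FullGroup

section SigmaInter

variable {X : Type*} [TopologicalSpace X] {T : X ≃ₜ X}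

theorem sigma_union_mem {K : Subgroup (topologicalFullGroup T)} {U V : Set X}
    (hU : IsThreeTower T U) (hV : IsThreeTower T V) (h : IsThreeTower T (U ∪ V))
    (hd : Disjoint U V) (hUK : sigma T U hU ∈ K) (hVK : sigma T V hV ∈ K) :
    sigma T (U ∪ V) h ∈ K := by
  rw [sigma_eq_rho] at *
  rw [h.isTower.rho_union hU.isTower hV.isTower hd]
  exact K.mul_mem hUK hVK

theorem IsTower.rho_set_congr {ι : Type*} [Finite ι] {g : ι → topologicalFullGroup T}
    {U V : Set X} (hU : IsTower g U) (hV : IsTower g V) (h : U = V) (π : Equiv.Perm ι) :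
    hU.rho π = hV.rho π := by
  subst h; rfl

/-- If the towers over `U` and `V` meet only in `T² U ∩ V`, then the commutator of `σ_V` and
`σ_U⁻¹` is `σ_D` with `D = T U ∩ T⁻¹ V`. -/
theorem sigma_inter_mem {K : Subgroup (topologicalFullGroup T)} {U V D : Set X}
    (hU : IsThreeTower T U) (hV : IsThreeTower T V) (hD : IsThreeTower T D)
    (hDUV : ∀ x, x ∈ D ↔ (gen T)⁻¹ • x ∈ U ∧ gen T • x ∈ V)
    (hd : ∀ u ∈ U, ∀ v ∈ V, ∀ i j, genPow T i • u = genPow T j • v → i = 2 ∧ j = 0)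
    (hUK : sigma T U hU ∈ K) (hVK : sigma T V hV ∈ K) : sigma T D hD ∈ K := by
  -- Here `E = TD = T²U ∩ V` is the only overlap of the two towers. Over it, `T⁻¹E, E, TE, T²E` is a
  -- four-level tower.
  set E : Set X := {x | (gen T)⁻¹ • x ∈ D} with hEdef
  have hEc : IsClopen E := isClopen_preimage_smul _ hD.isClopen
  have hE : ∀ x ∈ E, ∃ u ∈ U, genPow T 2 • u = x ∧ genPow T 1 • u = (gen T)⁻¹ • x := by
    intro x hx
    refine ⟨_, ((hDUV _).1 hx).1, ?_, ?_⟩ <;> simp [genPow, pow_two, mul_smul]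
  have hEV : E ⊆ V := fun x hx => by simpa using ((hDUV _).1 hx).2
  set g := sigma T U hU
  have hVt := hV.isTower
  have hUt := hU.isTower
  have hgρ : g = hUt.rho (finRotate 3) := sigma_eq_rho hU
  have hfix : ∀ v ∈ V, ∀ i, (v ∉ E ∨ i ≠ 0) → g⁻¹ • genPow T i • v = genPow T i • v := by
    intro v hv i hi
    rw [inv_smul_eq_iff, eq_comm, hgρ]
    refine hUt.rho_smul_of_notMem _ fun j u hu e => ?_
    obtain ⟨rfl, rfl⟩ := hd u hu v hv j i e
    refine hi.elim (fun h => h ?_) fun h => h rfl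
    have e' : v = gen T • gen T • u := by simpa [genPow, pow_two, mul_smul] using e.symm
    change (gen T)⁻¹ • v ∈ D
    rw [hDUV, e']
    simp only [inv_smul_smul]
    exact ⟨hu, e' ▸ hv⟩
  have hmove : ∀ v ∈ E, g⁻¹ • v = (gen T)⁻¹ • v := by
    intro v hv
    obtain ⟨u, hu, e2, e1⟩ := hE v hv
    rw [inv_smul_eq_iff, ← e1, hgρ, hUt.rho_smul _ 1 hu]
    exact e2.symm
  have seg0 : ∀ x : X, segment T (-1) 3 0 • x = (gen T)⁻¹ • x := by simp [segment]
  have segs : ∀ (x : X) (i : Fin 3), segment T (-1) 3 i.succ • x = genPow T i • x := by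
    intro x i
    rw [segment, genPow, ← zpow_natCast]
    congr 2
    simp
  have hS : IsTower (segment T (-1) 3) E := by
    have key : ∀ v ∈ E, ∀ w ∈ E, ∀ j : Fin 3,
        segment T (-1) 3 0 • v ≠ segment T (-1) 3 j.succ • w := by
      intro v hv w hw j e
      obtain ⟨u, hu, _, e1⟩ := hE v hv
      rw [seg0, segs, ← e1] at e
      exact absurd (hd u hu w (hEV hw) 1 j e).1 (by decide)
    refine ⟨hEc, fun i j v hv w hw => ?_⟩
    refine Fin.cases ?_ (fun i => ?_) i <;> refine Fin.cases ?_ (fun j => ?_) j <;> intro e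
    · rfl
    · exact (key v hv w hw j e).elim
    · exact (key w hw v hv i e.symm).elim
    · rw [segs, segs] at e
      rw [hVt.index_eq i j v (hEV hv) w (hEV hw) e]
  -- On the four levels, `a` carries `σ_V`, `b` its conjugate by `σ_U⁻¹` (which moves `E` to `T⁻¹E`
  -- and fixes the rest), and `c` carries `σ_D`. Over `V \ E` the conjugation changes nothing.
  let a : Fin 3 ↪ Fin 4 := ⟨![1, 2, 3], by decide⟩
  let b : Fin 3 ↪ Fin 4 := ⟨![0, 2, 3], by decide⟩
  let c : Fin 3 ↪ Fin 4 := ⟨![0, 1, 2], by decide⟩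
  have hFc : IsClopen (V \ E) := hV.isClopen.diff hEc
  have hVE : E ∪ V \ E = V := Set.union_sdiff_cancel hEV
  have hF := hVt.mono hFc Set.sdiff_subset
  have hVE' : IsTower (genPow T) (E ∪ V \ E) := hVE.symm ▸ hVt
  have eV : sigma T V hV =
      hS.rho ((finRotate 3).viaFintypeEmbedding a) * hF.rho (finRotate 3) := by
    have : sigma T V hV = hVE'.rho (finRotate 3) := by
      rw [sigma_eq_rho, IsTower.rho_set_congr _ hVE' hVE.symm]
    rw [this, hVE'.rho_union (hVt.mono hEc hEV) hF Set.disjoint_sdiff_right, ← hS.rho_comp a]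
    congr 1
    refine IsTower.rho_congr _ _ (fun i w _ => ?_) _
    rw [← segs]
    fin_cases i <;> rfl
  have eV' : g⁻¹ * sigma T V hV * g =
      hS.rho ((finRotate 3).viaFintypeEmbedding b) * hF.rho (finRotate 3) := by
    have : g⁻¹ * sigma T V hV * g = (hVE'.conj g⁻¹).rho (finRotate 3) := by
      rw [hVE'.rho_conj, inv_inv, sigma_eq_rho, IsTower.rho_set_congr _ hVE' hVE.symm]
    rw [this, (hVE'.conj g⁻¹).rho_union ((hVt.mono hEc hEV).conj _) (hF.conj _)
      Set.disjoint_sdiff_right, ← hS.rho_comp b]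
    congr 1
    · refine IsTower.rho_congr _ _ (fun i w hw => ?_) _
      rw [mul_smul]
      refine Fin.cases ?_ (fun j => ?_) i
      · change g⁻¹ • genPow T 0 • w = segment T (-1) 3 0 • w
        rw [seg0, ← hmove w hw]
        simp [genPow]
      · rw [hfix w (hEV hw) _ (.inr (Fin.succ_ne_zero j)), ← segs]
        fin_cases j <;> rfl
    · refine IsTower.rho_congr _ _ (fun i w hw => ?_) _
      rw [mul_smul, hfix w hw.1 _ (.inl hw.2)]
  have eD : sigma T D hD = hS.rho ((finRotate 3).viaFintypeEmbedding c) := by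
    have hfam : ∀ i, ∀ w ∈ E, segment T (-1) 3 (c i) • w = (genPow T i * (gen T)⁻¹) • w := by
      intro i w _
      rw [segment, genPow, ← zpow_natCast, ← zpow_neg_one (gen T), ← zpow_add]
      congr 2
      fin_cases i <;> rfl
    have hDE : D = {x | ((gen T)⁻¹)⁻¹ • x ∈ E} := by ext x; simp [hEdef]
    have hD' : IsTower (genPow T) {x | ((gen T)⁻¹)⁻¹ • x ∈ E} := hDE ▸ hD.isTower
    have : sigma T D hD = hD'.rho (finRotate 3) := by
      rw [sigma_eq_rho, IsTower.rho_set_congr _ hD' hDE]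
    rw [this, hD'.rho_translate ((hS.comp c).congr hfam), ← hS.rho_comp c]
    exact (IsTower.rho_congr _ _ hfam _).symm
  -- The parts over `V \ E` cancel, leaving `(1 2 3)(0 2 3)⁻¹ = (0 1 2)`.
  have : sigma T D hD = sigma T V hV * (g⁻¹ * sigma T V hV * g)⁻¹ := by
    rw [eV', eV, eD, mul_inv_rev, mul_assoc, mul_inv_cancel_left, ← map_inv, ← map_mul]
    congr 1
    decide
  rw [this]
  exact K.mul_mem hVK (K.inv_mem (K.mul_mem (K.mul_mem (K.inv_mem hUK) hVK) hUK))

end SigmaInter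

end FullGroup

/-! ### Cylinders over windows of coordinates. -/

namespace ZSubshift

open SymbolicDynamics.FullShift FullGroup

variable {A : Type*} [TopologicalSpace A]

theorem gen_smul_apply (Ω : Subshift A ℤ) (x : Ω.carrier) (k : ℤ) :
    (gen (leftShift Ω) • x).1 k = x.1 (k + 1) := rfl

theorem gen_inv_smul_apply (Ω : Subshift A ℤ) (x : Ω.carrier) (k : ℤ) :
    ((gen (leftShift Ω))⁻¹ • x).1 k = x.1 (k - 1) := by
  conv_rhs => rw [← smul_inv_smul (gen (leftShift Ω)) x, gen_smul_apply, sub_add_cancel]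

theorem gen_pow_smul_apply (Ω : Subshift A ℤ) (x : Ω.carrier) (n : ℕ) (k : ℤ) :
    (gen (leftShift Ω) ^ n • x).1 k = x.1 (k + n) := by
  induction n generalizing k with
  | zero => simp
  | succ n ih =>
    rw [pow_succ', mul_smul, gen_smul_apply, ih]
    exact congrArg x.1 (by push_cast; ring)

/-- The sequences of `Ω` that agree with `w` on the coordinates `-m, …, n`. -/
def box (Ω : Subshift A ℤ) (w : Ω.carrier) (m n : ℕ) : Set Ω.carrier :=
  {x | ∀ k : ℤ, -(m : ℤ) ≤ k → k ≤ n → x.1 k = w.1 k}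

theorem mem_box_self (Ω : Subshift A ℤ) (w : Ω.carrier) (m n : ℕ) : w ∈ box Ω w m n :=
  fun _ _ _ => rfl

theorem box_eq_of_mem {Ω : Subshift A ℤ} {w x : Ω.carrier} {m n : ℕ} (h : x ∈ box Ω w m n) :
    box Ω x m n = box Ω w m n := by
  ext y
  exact ⟨fun hy k h1 h2 => (hy k h1 h2).trans (h k h1 h2),
    fun hy k h1 h2 => (hy k h1 h2).trans (h k h1 h2).symm⟩

theorem box_anti {Ω : Subshift A ℤ} (w : Ω.carrier) {m n m' n' : ℕ} (hm : m ≤ m') (hn : n ≤ n') :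
    box Ω w m' n' ⊆ box Ω w m n :=
  fun _ hx k h1 h2 => hx k (by omega) (by omega)

theorem box_one_one (Ω : Subshift A ℤ) (w : Ω.carrier) :
    box Ω w 1 1 = cylinder Ω ![w.1 (-1)] ![w.1 0, w.1 1] := by
  ext x
  simp only [box, cylinder, Set.mem_ofPred_eq, Fin.forall_fin_one, Fin.forall_fin_two]
  refine ⟨fun h => ⟨?_, ?_, ?_⟩, fun ⟨h1, h2, h3⟩ k hk hk' => ?_⟩
  · simpa using h (-1) (by simp) (by simp)
  · simpa using h 0 (by simp) (by simp)
  · simpa using h 1 (by simp) (by simp)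
  · obtain rfl | rfl | rfl : k = -1 ∨ k = 0 ∨ k = 1 := by omega
    · simpa using h1
    · simpa using h2
    · simpa using h3

theorem isClopen_box [DiscreteTopology A] (Ω : Subshift A ℤ) (w : Ω.carrier) (m n : ℕ) :
    IsClopen (box Ω w m n) := by
  have : box Ω w m n = ⋂ k : Set.Icc (-(m : ℤ)) n, {x : Ω.carrier | x.1 k = w.1 k} := by
    ext x; simp [box]
  rw [this]
  exact isClopen_iInter_of_finite fun k => (isClopen_discrete {w.1 k}).preimage
    ((continuous_apply (k : ℤ)).comp continuous_subtype_val)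

theorem exists_box_subset (Ω : Subshift A ℤ) {U : Set Ω.carrier} (hU : IsOpen U)
    {x : Ω.carrier} (hx : x ∈ U) : ∃ N : ℕ, box Ω x N N ⊆ U := by
  obtain ⟨O, hO, rfl⟩ := isOpen_induced_iff.1 hU
  obtain ⟨I, u, hu, hI⟩ := isOpen_pi_iff.1 hO x.1 hx
  refine ⟨I.sup Int.natAbs, fun y hy => hI fun i hi => ?_⟩
  have hle : i.natAbs ≤ I.sup Int.natAbs := Finset.le_sup (f := Int.natAbs) hi
  rw [hy i (by omega) (by omega)]
  exact (hu i hi).2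

section Generation

variable [DiscreteTopology A] {Ω : Subshift A ℤ}

theorem Dagger.isThreeTower_box (h : Dagger Ω) (w : Ω.carrier) {m n : ℕ} (hm : 1 ≤ m)
    (hn : 1 ≤ n) : IsThreeTower (leftShift Ω) (box Ω w m n) := by
  refine (IsTower.mono (h.isThreeTower (w.1 (-1)) (w.1 0) (w.1 1)).isTower
    (isClopen_box Ω w m n) ?_).isThreeTower
  rw [← box_one_one]
  exact box_anti w hm hn

/-- All `σ_U` with `U` determined by the coordinates `-m, …, n` belong to `K`. -/
def SigmaBoxMem (h : Dagger Ω) (K : Subgroup (topologicalFullGroup (leftShift Ω)))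
    (m n : ℕ) : Prop :=
  ∃ (hm : 1 ≤ m) (hn : 1 ≤ n), ∀ w, sigma _ (box Ω w m n) (h.isThreeTower_box w hm hn) ∈ K

variable {h : Dagger Ω} {K : Subgroup (topologicalFullGroup (leftShift Ω))}

/-- Take `U` around `T⁻¹w` and `V` around `Tw`. Then `TU` fixes the coordinates `[-m-1, n-1]` and
`T⁻¹V` fixes `[-m'+1, n'+1]`; these windows leave no gap, and their union is `[-M, N]`. -/
theorem SigmaBoxMem.combine {m n m' n' M N : ℕ} (h₁ : SigmaBoxMem h K m n)
    (h₂ : SigmaBoxMem h K m' n') (hM : M = max (m + 1) (m' - 1)) (hN : N = max (n - 1) (n' + 1)) :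
    SigmaBoxMem h K M N := by
  obtain ⟨hm, hn, h₁⟩ := h₁
  obtain ⟨hm', hn', h₂⟩ := h₂
  refine ⟨by omega, by omega, fun w => ?_⟩
  refine sigma_inter_mem (h.isThreeTower_box ((gen (leftShift Ω))⁻¹ • w) hm hn)
    (h.isThreeTower_box (gen (leftShift Ω) • w) hm' hn') _ (fun x => ⟨fun hx => ⟨?_, ?_⟩, fun ⟨hx, hx'⟩ => ?_⟩) ?_
    (h₁ _) (h₂ _)
  · intro k hk hk'
    rw [gen_inv_smul_apply, gen_inv_smul_apply]
    exact hx _ (by omega) (by omega)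
  · intro k hk hk'
    rw [gen_smul_apply, gen_smul_apply]
    exact hx _ (by omega) (by omega)
  · intro k hk hk'
    by_cases hcase : -(m : ℤ) - 1 ≤ k ∧ k ≤ (n : ℤ) - 1
    · have := hx (k + 1) (by omega) (by omega)
      simpa only [gen_inv_smul_apply, add_sub_cancel_right] using this
    · have := hx' (k - 1) (by omega) (by omega)
      simpa only [gen_smul_apply, sub_add_cancel] using this
  · intro u hu v hv i j e
    have eu := hu 1 (by omega) (by omega)
    have ev := hv (-1) (by omega) (by omega)
    rw [gen_inv_smul_apply] at eu
    rw [gen_smul_apply] at ev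
    have hy1 : (genPow (leftShift Ω) i • u).1 (1 - (i : ℕ)) = w.1 0 := by
      rw [genPow, gen_pow_smul_apply, sub_add_cancel, eu]
      rfl
    have hy2 : (genPow (leftShift Ω) j • v).1 (-1 - (j : ℕ)) = w.1 0 := by
      rw [genPow, gen_pow_smul_apply, sub_add_cancel, ev]
      rfl
    by_contra hne
    -- A common point of levels `i` and `j` has the letter `w.1 0` at the positions `1 - i` and `-1
    -- - j`. Their distance `2 - i + j` is at most 4, so (†) forces it to be 0.
    have hpos : 0 < 2 - (i : ℕ) + j := by
      by_contra h0
      exact hne ⟨Fin.ext (show (i : ℕ) = 2 by omega), Fin.ext (show (j : ℕ) = 0 by omega)⟩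
    refine h.apply_ne (genPow (leftShift Ω) j • v) (-1 - (j : ℕ)) hpos (by omega) ?_
    rw [hy2, ← hy1, e]
    exact congrArg (genPow (leftShift Ω) j • v).1 (by omega)

/-- Combining with the window `(1, 1)` on one side or the other lengthens a window to the left or to
the right, the other length remaining 2. One last combination of a left-long and a right-long window
gives a symmetric one. -/
theorem SigmaBoxMem.diagonal (h₁ : SigmaBoxMem h K 1 1) (N : ℕ) (hN : 1 ≤ N) :
    SigmaBoxMem h K N N := by
  have left : ∀ m, SigmaBoxMem h K (m + 2) 2 := fun m => by
    induction m with
    | zero => exact h₁.combine h₁ rfl rfl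
    | succ m ih => exact ih.combine h₁ (by omega) rfl
  have right : ∀ n, SigmaBoxMem h K 2 (n + 2) := fun n => by
    induction n with
    | zero => exact h₁.combine h₁ rfl rfl
    | succ n ih => exact h₁.combine ih rfl (by omega)
  match N, hN with
  | 1, _ => exact h₁
  | 2, _ => exact left 0
  | N + 3, _ => exact (left N).combine (right N) (by omega) (by omega)

omit [DiscreteTopology A] in
theorem sigma_sUnion_mem {C : Set (Set Ω.carrier)} (hC : C.Finite)
    (hd : ∀ U ∈ C, ∀ V ∈ C, U ≠ V → Disjoint U V)
    (hK : ∀ U ∈ C, ∃ hU : IsThreeTower (leftShift Ω) U, sigma _ U hU ∈ K) :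
    ∀ hU : IsThreeTower (leftShift Ω) (⋃₀ C), sigma _ (⋃₀ C) hU ∈ K := by
  induction C, hC using Set.Finite.induction_on with
  | empty =>
    intro hU
    have : IsTower (genPow (leftShift Ω)) ∅ := by simpa using hU.isTower
    rw [sigma_eq_rho]
    simp only [Set.sUnion_empty, this.rho_eq_one_of_empty, K.one_mem]
  | @insert U C hUC hfin ih =>
    intro hU
    have hsub : ∀ V ∈ C, V ∈ insert U C := fun V hV => Set.mem_insert_of_mem U hV
    obtain ⟨hU', hUK⟩ := hK U (Set.mem_insert U C)
    have hcl : IsClopen (⋃₀ C) := by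
      rw [Set.sUnion_eq_biUnion]
      exact hfin.isClopen_biUnion fun V hV => (hK V (hsub V hV)).1.isClopen
    have hCt := (hU.isTower.mono hcl (Set.sUnion_mono (Set.subset_insert U C))).isThreeTower
    have := ih (fun V hV W hW => hd V (hsub V hV) W (hsub W hW)) (fun V hV => hK V (hsub V hV)) hCt
    have hdis : Disjoint U (⋃₀ C) := Set.disjoint_sUnion_right.2 fun V hV =>
      hd U (Set.mem_insert U C) V (hsub V hV) (by rintro rfl; exact hUC hV)
    have := sigma_union_mem hU' hCt (by rwa [Set.sUnion_insert] at hU) hdis hUK this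
    simpa only [Set.sUnion_insert] using this

variable [Finite A]

theorem SigmaBoxMem.sigma_mem (h₁ : SigmaBoxMem h K 1 1) [CompactSpace Ω.carrier]
    {U : Set Ω.carrier} (hU : IsThreeTower (leftShift Ω) U) : sigma _ U hU ∈ K := by
  choose N hN using fun x : U => exists_box_subset Ω hU.isClopen.isOpen x.2
  obtain ⟨t, ht⟩ := hU.isClopen.isClosed.isCompact.elim_finite_subcover
    (fun x : U => box Ω x.1 (N x) (N x)) (fun x => (isClopen_box Ω _ _ _).isOpen)
    fun x hx => Set.mem_iUnion.2 ⟨⟨x, hx⟩, mem_box_self _ _ _ _⟩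
  -- A common radius for the finite subcover; the `+ 1` keeps it positive, as the windows require.
  -- Boxes of equal radius are equal or disjoint.
  set M := t.sup N + 1
  have hsat : ∀ x ∈ U, box Ω x M M ⊆ U := fun x hx => by
    obtain ⟨y, hy, hxy⟩ := Set.mem_iUnion₂.1 (ht hx)
    have hle : N y ≤ M := (Finset.le_sup (f := N) hy).trans (Nat.le_succ _)
    exact (box_anti x hle hle).trans ((box_eq_of_mem hxy).subset.trans (hN y))
  have hfin : ((fun x => box Ω x M M) '' U).Finite := by
    refine (Set.finite_range fun w : Set.Icc (-(M : ℤ)) M → A =>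
      {y : Ω.carrier | ∀ k : Set.Icc (-(M : ℤ)) M, y.1 k = w k}).subset ?_
    rintro _ ⟨x, -, rfl⟩
    refine ⟨fun k => x.1 k, ?_⟩
    ext y
    simp [box]
  have hUeq : U = ⋃₀ ((fun x => box Ω x M M) '' U) := by
    refine Set.Subset.antisymm (fun x hx => ⟨_, ⟨x, hx, rfl⟩, mem_box_self _ _ _ _⟩) ?_
    rintro x ⟨_, ⟨y, hy, rfl⟩, hx⟩
    exact hsat y hy hx
  obtain ⟨hM, hM', hbox⟩ := h₁.diagonal M (by omega)
  have := sigma_sUnion_mem (K := K) hfin ?_ ?_ (hUeq ▸ hU)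
  · simpa only [← hUeq] using this
  · rintro _ ⟨x, -, rfl⟩ _ ⟨y, -, rfl⟩ hne
    refine Set.disjoint_left.2 fun z hz hz' => hne ?_
    exact (box_eq_of_mem hz).symm.trans (box_eq_of_mem hz')
  · rintro _ ⟨x, -, rfl⟩
    exact ⟨_, hbox x⟩

omit [Finite A] in
theorem sigmaBoxMem_generators (h : Dagger Ω) :
    SigmaBoxMem h (Subgroup.closure (generators Ω h)) 1 1 := by
  refine ⟨le_rfl, le_rfl, fun w => Subgroup.subset_closure ⟨w.1 (-1), w.1 0, w.1 1, ?_, ?_⟩⟩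
  · refine ⟨w.1, w.2, -1, fun i => ?_⟩
    fin_cases i <;> rfl
  · congr 1
    exact box_one_one Ω w

theorem finite_generators (h : Dagger Ω) : (generators Ω h).Finite := by
  refine (Set.finite_range fun p : A × A × A => sigma (leftShift Ω)
    (cylinder Ω ![p.1] ![p.2.1, p.2.2]) (h.isThreeTower _ _ _)).subset ?_
  rintro _ ⟨a, b, c, -, rfl⟩
  exact ⟨(a, b, c), rfl⟩

end Generation

end ZSubshift

theorem mainTheorem5 {A : Type*} [Finite A] [TopologicalSpace A] [DiscreteTopology A]
    (Ω : SymbolicDynamics.FullShift.Subshift A ℤ)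
    (hmin : FullGroup.IsMinimal (ZSubshift.leftShift Ω))
    (hdag : ZSubshift.Dagger Ω) :
    (ZSubshift.generators Ω hdag).Finite ∧
      Subgroup.closure (ZSubshift.generators Ω hdag) =
        commutator (FullGroup.topologicalFullGroup (ZSubshift.leftShift Ω)) := by
  have : CompactSpace Ω.carrier := isCompact_iff_compactSpace.1 Ω.isClosed.isCompact
  refine ⟨ZSubshift.finite_generators hdag, le_antisymm ?_ (hmin.commutator_le.trans ?_)⟩
  · refine (Subgroup.closure_le _).2 ?_
    rintro _ ⟨a, b, c, -, rfl⟩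
    exact FullGroup.sigma_mem_commutator _
  · refine (Subgroup.closure_le _).2 ?_
    rintro _ ⟨U, hU, rfl⟩
    exact (ZSubshift.sigmaBoxMem_generators hdag).sigma_mem hU
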